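/- Let $\mathbb G$ be a Carnot group, i.e. a connected, simply connected, nilpotent Lie group whose Lie algebra has a stratification $\mathfrak g=\mathfrak g_1\oplus\dots\oplus\mathfrak g_s$ with $\mathfrak g_{j+1}=[\mathfrak g_j,\mathfrak g_1]$ for $1\le j<s$, $\mathfrak g_s\ne\{0\}$ and $[\mathfrak g_s,\mathfrak g]=\{0\}$. Identify $\mathbb G$ with $\mathbb R^n$ by exponential coordinates, and let $X_1,\dots,X_m$ be a basis of $\mathfrak g_1$, regarded as left-invariant vector fields on $\mathbb R^n$. The product $\mathbb G\times\mathbb R\equiv\mathbb R^{n+1}$ is the Carnot group whose Lie algebra $\mathfrak g\times\mathbb R$ has the stratification $(\mathfrak g_1\times\mathbb R)\oplus(\mathfrak g_2\times\{0\})\oplus\dots\oplus(\mathfrak g_s\times\{0\})$; let $Y_1,\dots,Y_{m+1}$ be a basis of its first layer $\mathfrak g_1\times\mathbb R$, regarded as left-invariant vector fields on $\mathbb R^{n+1}$. For a tuple $Z=(Z_1,\dots,Z_k)$ of smooth vector fields $Z_i=\sum_j a_{ij}\partial_{x_j}$ on $\mathbb R^N$, an open set $U\subset\mathbb R^N$ and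 $v\in L^1_{loc}(U)$, say that $D_Zv$ is a finite measure on $U$ if there is an $\mathbb R^k$-valued Borel measure $D_Zv=(D_{Z_1}v,\dots,D_{Z_k}v)$ of finite total variation on $U$ such that $$\sum_{i=1}^k\int_U\varphi_i\,d(D_{Z_i}v)=-\int_U v\,\sum_{i=1}^k\sum_{j=1}^N\partial_{x_j}(a_{ij}\varphi_i)\,d\mathscr L^N\qquad\text{for all }\varphi\in C^1_c(U;\mathbb R^k).$$ For an open set $\Omega\subset\mathbb G$, $BV_H(\Omega)$ is the set of $u\in L^1(\Omega)$ such that $D_Xu$ is a finite measure on $\Omega$. A set $E\subset\Omega\times\mathbb R$ has finite $H$-perimeter in $\Omega\times\mathbb R$ if $\chi_E\in L^1_{loc}(\Omega\times\mathbb R)$ and $D_Y\chi_E$ is a finite measure on $\Omega\times\mathbb R$. **Theorem.** Suppose that $\Omega\subset\mathbb G$ is open and bounded, and let $u\in L^1(\Omega)$. Then $u$ belongs to $BV_H(\Omega)$ if and only if its subgraph $E_u:=\{(x,t)\in\Omega\times\mathbb R:t<u(x)\}$ has finite $H$-perimeter in $\Omega\times\mathbb R$. -/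

import Mathlib

open MeasureTheory
open scoped ContDiff

noncomputable section

/-! ### Carnot groups in exponential coordinates -/

section LieAlgebra

variable {E : Type*} [NormedAddCommGroup E] [NormedSpace ℝ E]

/-- The left-invariant vector field on `E`, for the group law `mul` with identity `0`, whose value
at the identity is `v`: at `x` it is the image of `v` under the differential at `0` of the left
translation `y ↦ mul x y`. -/
def leftInvariantField (mul : E → E → E) (v : E) (x : E) : E :=
  fderiv ℝ (mul x) 0 v

/-- The bracket of the Lie algebra of the group law `mul` with identity `0`. The Lie algebra is the
tangent space `E` at `0`, and the bracket of `v` and `w` is the value at `0` of the Lie bracket of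
the left-invariant vector fields extending `v` and `w`. -/
def groupBracket (mul : E → E → E) (v w : E) : E :=
  VectorField.lieBracket ℝ (leftInvariantField mul v) (leftInvariantField mul w) 0

/-- If left translations are smooth, jointly in both factors, then so are the left-invariant
vector fields. -/
lemma contDiff_leftInvariantField {mul : E → E → E}
    (h : ContDiff ℝ ∞ (fun p : E × E => mul p.1 p.2)) (v : E) :
    ContDiff ℝ ∞ (leftInvariantField mul v) := by
  have h1 : ContDiff ℝ ∞ (fun x : E => fderiv ℝ (mul x) 0) :=
    ContDiff.fderiv (f := mul) (g := fun _ : E => (0 : E)) (n := ∞) (m := ∞) h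
      contDiff_const (by simp)
  exact h1.clm_apply contDiff_const

end LieAlgebra

/-- A Carnot group, i.e. a connected, simply connected, nilpotent Lie group whose Lie algebra is
stratified, written in exponential coordinates.

The underlying manifold is a finite-dimensional vector space `E` (hence connected and simply
connected) with a smooth associative product `mul`. The law `smul_mul_smul` says that each line
`t ↦ t • x` is a one-parameter subgroup; since its velocity at time `0` is `x`, this means that the
exponential map from the Lie algebra `T₀E = E` to the group `E` is the identity map. It also
contains that `0` is the identity and that `-x` is the inverse of `x`.

The Lie algebra is stratified by `layer 1, …, layer step` (the other values of `layer` play no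
role); in particular it is nilpotent, and so is the group. -/
structure CarnotGroup (E : Type*) [NormedAddCommGroup E] [NormedSpace ℝ E]
    [FiniteDimensional ℝ E] where
  /-- The group law. -/
  mul : E → E → E
  mul_assoc : ∀ x y z, mul (mul x y) z = mul x (mul y z)
  smul_mul_smul : ∀ (s t : ℝ) (x : E), mul (s • x) (t • x) = (s + t) • x
  contDiff_mul : ContDiff ℝ ∞ (fun p : E × E => mul p.1 p.2)
  /-- The step `s` of the stratification. -/
  step : ℕ
  one_le_step : 1 ≤ step
  /-- The layers of the stratification, indexed from `1` to `step`. -/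
  layer : ℕ → Submodule ℝ E
  /-- The Lie algebra is the direct sum of the layers. -/
  isInternal_layer : DirectSum.IsInternal (fun j : Set.Icc 1 step => layer j)
  /-- `𝔤_{j+1} = [𝔤_j, 𝔤_1]` for `1 ≤ j < s`. -/
  layer_succ : ∀ j, 1 ≤ j → j < step →
    layer (j + 1) = Submodule.span ℝ {z | ∃ v ∈ layer j, ∃ w ∈ layer 1, z = groupBracket mul v w}
  /-- `𝔤_s ≠ 0`. -/
  layer_step_ne_bot : layer step ≠ ⊥
  /-- `[𝔤_s, 𝔤] = 0`. -/
  bracket_layer_step : ∀ v ∈ layer step, ∀ w, groupBracket mul v w = 0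

namespace CarnotGroup

variable {E : Type*} [NormedAddCommGroup E] [NormedSpace ℝ E] [FiniteDimensional ℝ E]

lemma zero_mul (G : CarnotGroup E) (x : E) : G.mul 0 x = x := by
  simpa using G.smul_mul_smul 0 1 x

lemma mul_zero (G : CarnotGroup E) (x : E) : G.mul x 0 = x := by
  simpa using G.smul_mul_smul 1 0 x

lemma neg_mul_self (G : CarnotGroup E) (x : E) : G.mul (-x) x = 0 := by
  simpa using G.smul_mul_smul (-1) 1 x

/-- The left-invariant vector field of a Carnot group determined by an element of its Lie
algebra. -/
def field (G : CarnotGroup E) (v : E) : E → E := leftInvariantField G.mul v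

/-- The product law of `G × ℝ`. -/
def prodRealMul (G : CarnotGroup E) (p q : E × ℝ) : E × ℝ := (G.mul p.1 q.1, p.2 + q.2)

/-- The stratification of `𝔤 × ℝ` is `(𝔤_1 × ℝ) ⊕ (𝔤_2 × {0}) ⊕ … ⊕ (𝔤_s × {0})`. -/
def prodRealLayer (G : CarnotGroup E) (j : ℕ) : Submodule ℝ (E × ℝ) :=
  (G.layer j).prod (if j = 1 then ⊤ else ⊥)

lemma contDiff_prodRealMul (G : CarnotGroup E) :
    ContDiff ℝ ∞ (fun p : (E × ℝ) × (E × ℝ) => G.prodRealMul p.1 p.2) := by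
  have h : ContDiff ℝ ∞ (fun p : (E × ℝ) × (E × ℝ) => G.mul p.1.1 p.2.1) :=
    G.contDiff_mul.comp (f := fun p : (E × ℝ) × (E × ℝ) => (p.1.1, p.2.1)) (by fun_prop)
  exact h.prodMk (by fun_prop)

lemma leftInvariantField_prodRealMul (G : CarnotGroup E) (v x : E × ℝ) :
    leftInvariantField G.prodRealMul v x = (G.field v.1 x.1, v.2) := by
  have hd : DifferentiableAt ℝ (G.mul x.1) 0 := by
    have : ContDiff ℝ ∞ (G.mul x.1) :=
      G.contDiff_mul.comp (f := fun y : E => (x.1, y)) (by fun_prop)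
    exact (this.differentiable (by simp)).differentiableAt
  have h1 : HasFDerivAt (fun y : E × ℝ => G.mul x.1 y.1)
      ((fderiv ℝ (G.mul x.1) 0).comp (ContinuousLinearMap.fst ℝ E ℝ)) 0 :=
    HasFDerivAt.comp (f := fun y : E × ℝ => y.1) (0 : E × ℝ) hd.hasFDerivAt hasFDerivAt_fst
  have h2 : HasFDerivAt (fun y : E × ℝ => x.2 + y.2) (ContinuousLinearMap.snd ℝ E ℝ) 0 :=
    hasFDerivAt_snd.const_add x.2
  have h3 := (h1.prodMk h2).fderiv
  unfold leftInvariantField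
  have h4 : G.prodRealMul x = fun y : E × ℝ => (G.mul x.1 y.1, x.2 + y.2) := rfl
  rw [h4, h3]
  rfl

lemma groupBracket_prodRealMul (G : CarnotGroup E) (v w : E × ℝ) :
    groupBracket G.prodRealMul v w = (groupBracket G.mul v.1 w.1, 0) := by
  have key : ∀ u : E × ℝ, HasFDerivAt (leftInvariantField G.prodRealMul u)
      (((fderiv ℝ (leftInvariantField G.mul u.1) 0).comp
        (ContinuousLinearMap.fst ℝ E ℝ)).prod 0) 0 := by
    intro u
    have hd : DifferentiableAt ℝ (leftInvariantField G.mul u.1) 0 :=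
      ((contDiff_leftInvariantField G.contDiff_mul u.1).differentiable
        (by simp)).differentiableAt
    have h1 : HasFDerivAt (fun y : E × ℝ => leftInvariantField G.mul u.1 y.1)
        ((fderiv ℝ (leftInvariantField G.mul u.1) 0).comp (ContinuousLinearMap.fst ℝ E ℝ)) 0 :=
      HasFDerivAt.comp (f := fun y : E × ℝ => y.1) (0 : E × ℝ) hd.hasFDerivAt hasFDerivAt_fst
    have h2 := h1.prodMk (hasFDerivAt_const (𝕜 := ℝ) u.2 (0 : E × ℝ))
    have h3 : leftInvariantField G.prodRealMul u
        = fun y : E × ℝ => (leftInvariantField G.mul u.1 y.1, u.2) := by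
      funext y
      exact G.leftInvariantField_prodRealMul u y
    rw [h3]
    exact h2
  unfold groupBracket
  rw [VectorField.lieBracket_eq]
  simp only [(key v).fderiv, (key w).fderiv, leftInvariantField_prodRealMul]
  simp [VectorField.lieBracket_eq, field]

/-- The Carnot group `G × ℝ`. -/
def prodReal (G : CarnotGroup E) : CarnotGroup (E × ℝ) where
  mul := G.prodRealMul
  mul_assoc x y z := by simp [prodRealMul, G.mul_assoc, add_assoc]
  smul_mul_smul s t x := by
    simp [prodRealMul, G.smul_mul_smul, Prod.ext_iff, add_mul]
  contDiff_mul := G.contDiff_prodRealMul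
  step := G.step
  one_le_step := G.one_le_step
  layer := G.prodRealLayer
  isInternal_layer := by
    have hI := G.isInternal_layer
    rw [DirectSum.isInternal_submodule_iff_iSupIndep_and_iSup_eq_top] at hI ⊢
    obtain ⟨hi, hs⟩ := hI
    constructor
    · rw [iSupIndep_iff_finsetSum_eq_zero_imp_eq_zero] at hi ⊢
      intro s v hv hsum
      have hv' : ∀ i ∈ s, (v i).1 ∈ G.layer i ∧
          (v i).2 ∈ (if (i : ℕ) = 1 then (⊤ : Submodule ℝ ℝ) else ⊥) :=
        fun i hi => Submodule.mem_prod.mp (hv i hi)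
      have hz1 := hi s (fun i => (v i).1) (fun i hi => (hv' i hi).1)
        (by simpa [Prod.fst_sum] using congrArg Prod.fst hsum)
      have hsum2 : ∑ i ∈ s, (v i).2 = 0 := by
        simpa [Prod.snd_sum] using congrArg Prod.snd hsum
      have hne : ∀ j ∈ s, (j : ℕ) ≠ 1 → (v j).2 = 0 := by
        intro j hj h
        have := (hv' j hj).2
        rw [if_neg h] at this
        simpa using this
      intro i hi
      refine Prod.ext (hz1 i hi) ?_
      by_cases h : (i : ℕ) = 1
      · rw [Finset.sum_eq_single_of_mem i hi] at hsum2
        · exact hsum2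
        · intro j hj hji
          exact hne j hj (fun h' => hji (Subtype.ext (h'.trans h.symm)))
      · exact hne i hi h
    · have hle : (⊤ : Submodule ℝ E) ≤
          (⨆ j : Set.Icc 1 G.step, G.prodRealLayer j).comap (LinearMap.inl ℝ E ℝ) := by
        rw [← hs]
        refine iSup_le fun j x hx => ?_
        have : ((x, 0) : E × ℝ) ∈ G.prodRealLayer j := by
          simp [prodRealLayer, Submodule.mem_prod, hx]
        exact (le_iSup (fun j : Set.Icc 1 G.step => G.prodRealLayer j) j) this
      rw [eq_top_iff]
      rintro ⟨x, t⟩ -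
      have h1 : ((x, 0) : E × ℝ) ∈ ⨆ j : Set.Icc 1 G.step, G.prodRealLayer j :=
        hle (Submodule.mem_top : x ∈ ⊤)
      have h2 : ((0, t) : E × ℝ) ∈ ⨆ j : Set.Icc 1 G.step, G.prodRealLayer j := by
        refine (le_iSup (fun j : Set.Icc 1 G.step => G.prodRealLayer j)
          ⟨1, le_rfl, G.one_le_step⟩) ?_
        simp [prodRealLayer, Submodule.mem_prod]
      simpa using add_mem h1 h2
  layer_succ j hj hjs := by
    have hne : j + 1 ≠ 1 := by omega
    apply le_antisymm
    · rintro ⟨x, t⟩ hx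
      simp only [prodRealLayer, if_neg hne, Submodule.mem_prod, Submodule.mem_bot] at hx
      obtain ⟨hx, rfl⟩ := hx
      have hle : G.layer (j + 1) ≤ (Submodule.span ℝ {z | ∃ v ∈ G.prodRealLayer j,
          ∃ w ∈ G.prodRealLayer 1, z = groupBracket G.prodRealMul v w}).comap
            (LinearMap.inl ℝ E ℝ) := by
        rw [G.layer_succ j hj hjs, Submodule.span_le]
        rintro z ⟨v, hv, w, hw, rfl⟩
        refine Submodule.subset_span ⟨(v, 0), ?_, (w, 0), ?_, ?_⟩
        · simp [prodRealLayer, Submodule.mem_prod, hv]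
        · simp [prodRealLayer, Submodule.mem_prod, hw]
        · simp [groupBracket_prodRealMul]
      exact hle hx
    · rw [Submodule.span_le]
      rintro z ⟨v, hv, w, hw, rfl⟩
      simp only [prodRealLayer, if_neg hne, SetLike.mem_coe, Submodule.mem_prod,
        Submodule.mem_bot, groupBracket_prodRealMul, and_true]
      rw [G.layer_succ j hj hjs]
      exact Submodule.subset_span ⟨v.1, hv.1, w.1, hw.1, rfl⟩
  layer_step_ne_bot := by
    obtain ⟨x, hx, hx0⟩ := Submodule.exists_mem_ne_zero_of_ne_bot G.layer_step_ne_bot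
    intro h
    have h1 : ((x, 0) : E × ℝ) ∈ G.prodRealLayer G.step := by
      simp [prodRealLayer, Submodule.mem_prod, hx]
    rw [h] at h1
    exact hx0 (by simpa using h1)
  bracket_layer_step v hv w := by
    rw [groupBracket_prodRealMul, G.bracket_layer_step v.1 hv.1 w.1]
    rfl

end CarnotGroup

/-! ### Functions of bounded `H`-variation with respect to a family of vector fields -/

section BVH

variable {E : Type*} [NormedAddCommGroup E] [NormedSpace ℝ E] {ι : Type*} [Fintype ι]

/-- The divergence of a vector field: in linear coordinates, `∑ j, ∂_j (F_j)`. -/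
def euclideanDiv (F : E → E) (x : E) : ℝ := LinearMap.trace ℝ E (fderiv ℝ F x).toLinearMap

/-- The `X`-divergence `div_X φ = ∑ i, div (φ_i X_i) = ∑ i, ∑ j, ∂_j (a_ij φ_i)` of a tuple of
functions `φ`, where `X_i = ∑ j, a_ij ∂_j`. Up to the sign, `φ_i ↦ div (φ_i X_i)` is the formal
adjoint of `X_i` with respect to the Lebesgue measure. -/
def divX (X : ι → E → E) (φ : E → ι → ℝ) (x : E) : ℝ :=
  ∑ i, euclideanDiv (fun y => φ y i • X i y) x

variable [MeasureSpace E]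

/-- The distributional derivative `D_H u` of `u` in `Ω` along the family `X` is an `ℝ^ι`-valued
Borel measure of finite total variation on `Ω`:
`∫_Ω φ · d(D_H u) = - ∫_Ω u div_X φ` for all `φ ∈ C_c^1(Ω; ℝ^ι)`.

The components of `D_H u` are signed measures on `E`, of which only the restriction to `Ω` is
relevant as `φ` is supported in `Ω`; signed measures are real-valued, and so they have finite total
variation. -/
def HasFiniteHVariation (X : ι → E → E) (Ω : Set E) (u : E → ℝ) : Prop :=
  ∃ D : ι → SignedMeasure E, ∀ φ : E → ι → ℝ,
    ContDiff ℝ 1 φ → HasCompactSupport φ → tsupport φ ⊆ Ω →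
      ∑ i, ∫ᵛ x, φ x i ∂•(D i) = - ∫ x in Ω, u x * divX X φ x

/-- `u ∈ BV_H(Ω)`: `u ∈ L¹(Ω)`, and `D_H u` is a measure of finite total variation on `Ω`. -/
def MemBVH (X : ι → E → E) (Ω : Set E) (u : E → ℝ) : Prop :=
  IntegrableOn u Ω ∧ HasFiniteHVariation X Ω u

/-- `S` has finite `H`-perimeter in `Ω`: the characteristic function of `S` is in `L¹_loc(Ω)`, and
its distributional derivative along `X` is a measure of finite total variation on `Ω`. -/
def HasFiniteHPerimeter (X : ι → E → E) (Ω : Set E) (S : Set E) : Prop :=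
  LocallyIntegrableOn (S.indicator (fun _ => (1 : ℝ))) Ω ∧
    HasFiniteHVariation X Ω (S.indicator (fun _ => (1 : ℝ)))

end BVH

/-- The subgraph `E_u = {(x, t) ∈ Ω × ℝ : t < u x}` of a function `u` on `Ω`. -/
def subgraphOn {E : Type*} (Ω : Set E) (u : E → ℝ) : Set (E × ℝ) :=
  {p | p.1 ∈ Ω ∧ p.2 < u p.1}

end

open Set Filter Topology

/-! ### Calculus of the divergence -/

section Divergence

variable {E : Type*} [NormedAddCommGroup E] [NormedSpace ℝ E]

/-! Left-invariant fields are smooth and depend linearly on their value at the identity. Finite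
variation along a basis of the first layer is therefore finite variation along each of its fields
(`hasFiniteHVariation_basis_iff`). On `G × ℝ` such a field is the horizontal lift of a first-layer
field `Z` of `G` plus a constant multiple of `∂_t`. The `∂_t`-derivative of the characteristic
function of the subgraph is minus the image of Lebesgue measure on `Ω` under the graph map. It is
finite because `Ω` is bounded (`hasFiniteFieldVariation_vertical`). What remains is a statement
about a single C¹ field `Z`: a function has finite variation along `Z` if and only if its subgraph
has finite variation along the lift of `Z` (`hasFiniteFieldVariation_iff_subgraph`).

From subgraph to function (`HasFiniteFieldVariation.of_subgraph`): test with `φ(x) b_k(t)`, where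
the cut-offs `b_k` tend to 1. Integrating in `t` leaves `div (φ Z)(x)` times the integral of `b_k`
over `(-∞, v x]`. The part over `(-∞, 0]` does not depend on `x` and drops out because `div (φ Z)`
has integral zero; the rest tends to `v x`. Hence `D_Z v` is the projection to `E` of the derivative
of the subgraph.

From function to subgraph (`HasFiniteFieldVariation.subgraph`): for a C¹ function `w`, the
derivative of the subgraph is the image of `Z w dx` under the graph map, so its mass is controlled
by the L¹ norm of `Z w`. A general `v` is mollified. Friedrichs' commutator estimate
(`setLIntegral_enorm_fderiv_convolution_le`) bounds `Z w_k` in L¹ away from the boundary, uniformly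
in `k`. Vague compactness (`exists_finite_measure_tendsto_integral`) gives finite limit measures,
and almost everywhere convergence `w_k → v` identifies them with the derivative of the subgraph of
`v`. -/

lemma euclideanDiv_add {F F' : E → E} {x : E} (hF : DifferentiableAt ℝ F x)
    (hF' : DifferentiableAt ℝ F' x) :
    euclideanDiv (fun y => F y + F' y) x = euclideanDiv F x + euclideanDiv F' x := by
  simp [euclideanDiv, fderiv_fun_add hF hF']

lemma euclideanDiv_eq_zero_of_notMem_tsupport {φ : E → ℝ} {Z : E → E} {x : E}
    (hx : x ∉ tsupport φ) : euclideanDiv (fun y => φ y • Z y) x = 0 := by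
  have h : (fun y => φ y • Z y) =ᶠ[𝓝 x] fun _ => 0 := by
    filter_upwards [notMem_tsupport_iff_eventuallyEq.1 hx] with y hy
    simp [hy]
  simp [euclideanDiv, h.fderiv_eq]

/-- The lift to `E × ℝ` of a vector field on `E`, constant and horizontal along `ℝ`. -/
def horizontalLift (Z : E → E) (p : E × ℝ) : E × ℝ := (Z p.1, 0)

lemma contDiff_horizontalLift {Z : E → E} {n : WithTop ℕ∞} (hZ : ContDiff ℝ n Z) :
    ContDiff ℝ n (horizontalLift Z) :=
  (hZ.comp contDiff_fst).prodMk contDiff_const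

variable [FiniteDimensional ℝ E]

lemma euclideanDiv_smul {φ : E → ℝ} {Z : E → E} {x : E} (hφ : DifferentiableAt ℝ φ x)
    (hZ : DifferentiableAt ℝ Z x) :
    euclideanDiv (fun y => φ y • Z y) x = φ x * euclideanDiv Z x + fderiv ℝ φ x (Z x) := by
  simp [euclideanDiv, fderiv_fun_smul hφ hZ, LinearMap.trace_smulRight]

lemma continuous_euclideanDiv {F : E → E} (hF : ContDiff ℝ 1 F) :
    Continuous (euclideanDiv F) := by
  have h : euclideanDiv F = fun x =>
      ((LinearMap.trace ℝ E) ∘ₗ (ContinuousLinearMap.coeLM ℝ)) (fderiv ℝ F x) := rfl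
  rw [h]
  exact (LinearMap.continuous_of_finiteDimensional _).comp (hF.continuous_fderiv (by simp))

lemma euclideanDiv_horizontalLift {Z : E → E} {p : E × ℝ} (hZ : DifferentiableAt ℝ Z p.1) :
    euclideanDiv (horizontalLift Z) p = euclideanDiv Z p.1 := by
  have h1 : HasFDerivAt (fun q : E × ℝ => Z q.1)
      ((fderiv ℝ Z p.1).comp (ContinuousLinearMap.fst ℝ E ℝ)) p :=
    HasFDerivAt.comp (f := fun y : E × ℝ => y.1) p hZ.hasFDerivAt hasFDerivAt_fst
  have h2 : HasFDerivAt (horizontalLift Z) _ p :=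
    h1.prodMk (hasFDerivAt_const (𝕜 := ℝ) (0 : ℝ) p)
  -- The differential of the lift is block diagonal with a zero vertical block, so its trace is that
  -- of the differential of `Z`.
  have h3 : (((fderiv ℝ Z p.1).comp (ContinuousLinearMap.fst ℝ E ℝ)).prod
      (0 : E × ℝ →L[ℝ] ℝ)).toLinearMap
      = LinearMap.prodMap (fderiv ℝ Z p.1).toLinearMap (0 : ℝ →ₗ[ℝ] ℝ) := by
    ext <;> simp
  rw [euclideanDiv, h2.fderiv, h3, LinearMap.trace_prodMap', map_zero, add_zero, euclideanDiv]

lemma euclideanDiv_smul_horizontalLift {φ : E × ℝ → ℝ} {Z : E → E} {p : E × ℝ}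
    (hφ : DifferentiableAt ℝ φ p) (hZ : DifferentiableAt ℝ Z p.1) :
    euclideanDiv (fun q => φ q • horizontalLift Z q) p
      = φ p * euclideanDiv Z p.1 + fderiv ℝ φ p (Z p.1, 0) := by
  have hd : DifferentiableAt ℝ (horizontalLift Z) p :=
    (hZ.comp p differentiableAt_fst).prodMk (differentiableAt_const _)
  rw [euclideanDiv_smul hφ hd, euclideanDiv_horizontalLift hZ, horizontalLift]

variable [MeasurableSpace E] [BorelSpace E] (μ : Measure E) [μ.IsAddHaarMeasure]

/-- Integration by parts against the constant function 1. -/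
lemma integral_fderiv_apply_eq_zero {f : E → ℝ} (hf : ContDiff ℝ 1 f) (hc : HasCompactSupport f)
    (v : E) : ∫ x, fderiv ℝ f x v ∂μ = 0 := by
  have hi : Integrable (fun x => fderiv ℝ f x v) μ :=
    ((hf.continuous_fderiv (by simp)).clm_apply continuous_const).integrable_of_hasCompactSupport
      (hc.fderiv_apply ℝ v)
  have h := integral_mul_fderiv_eq_neg_fderiv_mul_of_integrable (μ := μ) (f := fun _ : E => (1 : ℝ))
    (g := f) (v := v) (by simp) (by simpa using hi)
    (by simpa using hf.continuous.integrable_of_hasCompactSupport hc)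
    (fun _ _ => differentiableAt_const _) (fun x _ => (hf.differentiable (by simp)) x)
  simpa using h

/-- The divergence theorem for compactly supported vector fields. -/
lemma integral_euclideanDiv_eq_zero {F : E → E} (hF : ContDiff ℝ 1 F) (hc : HasCompactSupport F) :
    ∫ x, euclideanDiv F x ∂μ = 0 := by
  let b := Module.finBasis ℝ E
  let l : Fin (Module.finrank ℝ E) → E →L[ℝ] ℝ := fun i =>
    LinearMap.toContinuousLinearMap (b.coord i)
  have hl : ∀ i, ContDiff ℝ 1 (fun y => l i (F y)) := fun i => (l i).contDiff.comp hF
  have hcl : ∀ i, HasCompactSupport (fun y => l i (F y)) := fun i =>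
    hc.comp_left (g := l i) (map_zero _)
  have h : ∀ x, euclideanDiv F x = ∑ i, fderiv ℝ (fun y => l i (F y)) x (b i) := by
    intro x
    rw [euclideanDiv, LinearMap.trace_eq_matrix_trace ℝ b, Matrix.trace]
    refine Finset.sum_congr rfl fun i _ => ?_
    have : HasFDerivAt (fun y => l i (F y)) ((l i).comp (fderiv ℝ F x)) x :=
      (l i).hasFDerivAt.comp x ((hF.differentiable (by simp)) x).hasFDerivAt
    rw [this.fderiv]
    simp [LinearMap.toMatrix_apply, l]
  simp_rw [h]
  rw [integral_finsetSum]
  · exact Finset.sum_eq_zero fun i _ => integral_fderiv_apply_eq_zero μ (hl i) (hcl i) _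
  · intro i _
    exact (((hl i).continuous_fderiv (by simp)).clm_apply
      continuous_const).integrable_of_hasCompactSupport ((hcl i).fderiv_apply ℝ _)

end Divergence

/-! ### Finite variation along a single vector field -/

lemma integral_lsmul_toSignedMeasure {α : Type*} [MeasurableSpace α] (μ : Measure α)
    [IsFiniteMeasure μ] (f : α → ℝ) : ∫ᵛ x, f x ∂•μ.toSignedMeasure = ∫ x, f x ∂μ := by
  have h : ContinuousLinearMap.lsmul ℝ ℝ = (ContinuousLinearMap.lsmul ℝ ℝ (E := ℝ)).flip := by
    ext; simp
  rw [h, VectorMeasure.integral_toSignedMeasure]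

lemma integral_lsmul_toSignedMeasure_sub {α : Type*} [MeasurableSpace α] {μ ν : Measure α}
    [IsFiniteMeasure μ] [IsFiniteMeasure ν] {f : α → ℝ} (hμ : Integrable f μ)
    (hν : Integrable f ν) :
    ∫ᵛ x, f x ∂•(μ.toSignedMeasure - ν.toSignedMeasure) = ∫ x, f x ∂μ - ∫ x, f x ∂ν := by
  rw [VectorMeasure.integral_sub_vectorMeasure, integral_lsmul_toSignedMeasure,
    integral_lsmul_toSignedMeasure] <;> simpa [VectorMeasure.Integrable]

lemma integrableOn_mul_of_locallyIntegrableOn {E : Type*} [NormedAddCommGroup E] [MeasureSpace E]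
    [BorelSpace E] {Ω : Set E} {u g : E → ℝ}
    (hu : LocallyIntegrableOn u Ω) (hg : Continuous g) (hgc : HasCompactSupport g)
    (hgΩ : tsupport g ⊆ Ω) : IntegrableOn (fun x => u x * g x) Ω := by
  have h1 : IntegrableOn u (tsupport g) := hu.integrableOn_compact_subset hgΩ hgc
  have h2 : IntegrableOn (fun x => u x * g x) (tsupport g) :=
    h1.mul_continuousOn hg.continuousOn hgc
  have h3 : Integrable (fun x => u x * g x) := by
    rwa [integrableOn_iff_integrable_of_support_subset] at h2
    intro x hx
    exact subset_tsupport g (fun h0 => hx (by simp [h0]))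
  exact h3.integrableOn

section FieldVariation

variable {E : Type*} [NormedAddCommGroup E] [NormedSpace ℝ E]

lemma continuous_euclideanDiv_smul [FiniteDimensional ℝ E] {φ : E → ℝ} {Z : E → E}
    (hφ : ContDiff ℝ 1 φ) (hZ : ContDiff ℝ 1 Z) :
    Continuous (euclideanDiv fun y => φ y • Z y) :=
  continuous_euclideanDiv (hφ.smul hZ)

lemma hasCompactSupport_euclideanDiv_smul {φ : E → ℝ} {Z : E → E} (hφ : HasCompactSupport φ) :
    HasCompactSupport (euclideanDiv fun y => φ y • Z y) :=
  HasCompactSupport.intro hφ fun _ hx => euclideanDiv_eq_zero_of_notMem_tsupport hx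

variable [MeasureSpace E]

/-- The distributional derivative of `u` in `Ω` along the vector field `Z` is a finite signed
measure, written as a difference of two finite measures. -/
def HasFiniteFieldVariation (Z : E → E) (Ω : Set E) (u : E → ℝ) : Prop :=
  ∃ μ ν : Measure E, IsFiniteMeasure μ ∧ IsFiniteMeasure ν ∧ ∀ φ : E → ℝ,
    ContDiff ℝ 1 φ → HasCompactSupport φ → tsupport φ ⊆ Ω →
      ∫ x, φ x ∂μ - ∫ x, φ x ∂ν = - ∫ x in Ω, u x * euclideanDiv (fun y => φ y • Z y) x

lemma HasFiniteFieldVariation.congr_ae {Z : E → E} {Ω : Set E} {u v : E → ℝ}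
    (h : HasFiniteFieldVariation Z Ω u) (huv : u =ᵐ[volume.restrict Ω] v) :
    HasFiniteFieldVariation Z Ω v := by
  obtain ⟨μ, ν, hμ, hν, h⟩ := h
  refine ⟨μ, ν, hμ, hν, fun φ h1 h2 h3 => ?_⟩
  rw [h φ h1 h2 h3]
  congr 1
  refine integral_congr_ae ?_
  filter_upwards [huv] with x hx
  rw [hx]

variable [BorelSpace E] [FiniteDimensional ℝ E]

lemma integrableOn_mul_euclideanDiv_smul {Ω : Set E} {u φ : E → ℝ} {Z : E → E}
    (hu : LocallyIntegrableOn u Ω) (hZ : ContDiff ℝ 1 Z) (hφ : ContDiff ℝ 1 φ)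
    (hφc : HasCompactSupport φ) (hφΩ : tsupport φ ⊆ Ω) :
    IntegrableOn (fun x => u x * euclideanDiv (fun y => φ y • Z y) x) Ω := by
  refine integrableOn_mul_of_locallyIntegrableOn hu (continuous_euclideanDiv_smul hφ hZ)
    (hasCompactSupport_euclideanDiv_smul hφc) (subset_trans ?_ hφΩ)
  refine closure_minimal (fun x hx => ?_) (isClosed_tsupport φ)
  by_contra h
  exact hx (euclideanDiv_eq_zero_of_notMem_tsupport h)

lemma HasFiniteFieldVariation.add {Z W : E → E} {Ω : Set E} {u : E → ℝ}
    (hu : LocallyIntegrableOn u Ω) (hZ : ContDiff ℝ 1 Z) (hW : ContDiff ℝ 1 W)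
    (h : HasFiniteFieldVariation Z Ω u) (h' : HasFiniteFieldVariation W Ω u) :
    HasFiniteFieldVariation (fun x => Z x + W x) Ω u := by
  obtain ⟨μ, ν, hμ, hν, h⟩ := h
  obtain ⟨μ', ν', hμ', hν', h'⟩ := h'
  refine ⟨μ + μ', ν + ν', inferInstance, inferInstance, fun φ h1 h2 h3 => ?_⟩
  have hi : ∀ m : Measure E, IsFiniteMeasure m → Integrable φ m := fun m _ =>
    h1.continuous.integrable_of_hasCompactSupport h2
  have hd := h φ h1 h2 h3
  have hd' := h' φ h1 h2 h3
  rw [integral_add_measure (hi _ hμ) (hi _ hμ'), integral_add_measure (hi _ hν) (hi _ hν')]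
  have key : ∀ x, euclideanDiv (fun y => φ y • (Z y + W y)) x
      = euclideanDiv (fun y => φ y • Z y) x + euclideanDiv (fun y => φ y • W y) x := fun x => by
    simp_rw [smul_add]
    exact euclideanDiv_add ((h1.smul hZ).differentiable (by simp) x)
      ((h1.smul hW).differentiable (by simp) x)
  simp_rw [key, mul_add]
  rw [integral_add (integrableOn_mul_euclideanDiv_smul hu hZ h1 h2 h3)
    (integrableOn_mul_euclideanDiv_smul hu hW h1 h2 h3)]
  linarith

lemma HasFiniteFieldVariation.const_smul {Z : E → E} {Ω : Set E} {u : E → ℝ}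
    (c : ℝ) (h : HasFiniteFieldVariation Z Ω u) :
    HasFiniteFieldVariation (fun x => c • Z x) Ω u := by
  obtain ⟨μ, ν, hμ, hν, h⟩ := h
  have hc : ∀ φ : E → ℝ, ∀ x, euclideanDiv (fun y => φ y • (c • Z y)) x
      = euclideanDiv (fun y => (c * φ y) • Z y) x := fun φ x => by
    congr 1; ext y; rw [smul_smul, mul_comm]
  -- Measures only take nonnegative scalars: with `c = c⁺ - c⁻`, the factor `c⁻` exchanges the roles
  -- of the two measures.
  refine ⟨c.toNNReal • μ + (-c).toNNReal • ν, c.toNNReal • ν + (-c).toNNReal • μ,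
    inferInstance, inferInstance, fun φ h1 h2 h3 => ?_⟩
  have hi : ∀ m : Measure E, IsFiniteMeasure m → Integrable φ m := fun m _ =>
    h1.continuous.integrable_of_hasCompactSupport h2
  have hd := h (fun y => c * φ y) (contDiff_const.mul h1) h2.mul_left
    ((tsupport_mul_subset_right (f := fun _ => c)).trans h3)
  simp_rw [hc, ← hd, integral_const_mul]
  rw [integral_add_measure (hi _ inferInstance) (hi _ inferInstance),
    integral_add_measure (hi _ inferInstance) (hi _ inferInstance)]
  simp only [integral_smul_nnreal_measure, NNReal.smul_def, smul_eq_mul, Real.coe_toNNReal']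
  have := max_zero_sub_max_neg_zero_eq_self c
  linear_combination (∫ x, φ x ∂μ - ∫ x, φ x ∂ν) * this

variable {ι : Type*} [Fintype ι]

/-- A family of vector fields is of finite variation if and only if each of its members is. -/
lemma hasFiniteHVariation_iff {X : ι → E → E} {Ω : Set E} {u : E → ℝ}
    (hu : LocallyIntegrableOn u Ω) (hX : ∀ i, ContDiff ℝ 1 (X i)) :
    HasFiniteHVariation X Ω u ↔ ∀ i, HasFiniteFieldVariation (X i) Ω u := by
  classical
  constructor
  · rintro ⟨D, hD⟩ i
    let j := (D i).toJordanDecomposition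
    refine ⟨j.posPart, j.negPart, inferInstance, inferInstance, fun φ h1 h2 h3 => ?_⟩
    have hi : ∀ m : Measure E, IsFiniteMeasure m → Integrable φ m := fun m _ =>
      h1.continuous.integrable_of_hasCompactSupport h2
    have hj : D i = j.posPart.toSignedMeasure - j.negPart.toSignedMeasure :=
      (SignedMeasure.toSignedMeasure_toJordanDecomposition (D i)).symm
    -- A test tuple supported in the `i`-th slot isolates the `i`-th component.
    have key := hD (fun x => Pi.single i (φ x)) ?_ ?_ ?_
    · rw [Finset.sum_eq_single i] at key
      · simp only [Pi.single_eq_same] at key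
        rw [hj, integral_lsmul_toSignedMeasure_sub (hi _ inferInstance) (hi _ inferInstance)]
          at key
        rw [key]
        congr 1
        refine integral_congr_ae (Eventually.of_forall fun x => ?_)
        simp only [divX]
        rw [Finset.sum_eq_single i]
        · simp
        · intro k _ hk
          simp [Pi.single_eq_of_ne hk, euclideanDiv]
        · simp
      · intro k _ hk
        simp [Pi.single_eq_of_ne hk]
      · simp
    · rw [contDiff_pi]
      intro k
      by_cases hk : k = i
      · subst hk; simpa using h1
      · simpa [Pi.single_eq_of_ne hk] using contDiff_const
    · exact h2.comp_left (g := fun t => (Pi.single i t : ι → ℝ)) (by simp)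
    · exact (tsupport_comp_subset (g := fun t => (Pi.single i t : ι → ℝ)) (by simp) φ).trans h3
  · intro h
    choose μ ν hμ hν h using h
    refine ⟨fun i => (μ i).toSignedMeasure - (ν i).toSignedMeasure, fun φ h1 h2 h3 => ?_⟩
    have c1 : ∀ i, ContDiff ℝ 1 fun x => φ x i := fun i => contDiff_pi.1 h1 i
    have c2 : ∀ i, HasCompactSupport fun x => φ x i := fun i =>
      h2.comp_left (g := fun t : ι → ℝ => t i) rfl
    have c3 : ∀ i, tsupport (fun x => φ x i) ⊆ Ω := fun i =>
      (tsupport_comp_subset (g := fun t : ι → ℝ => t i) rfl φ).trans h3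
    have hi : ∀ m : Measure E, IsFiniteMeasure m → ∀ i, Integrable (fun x => φ x i) m :=
      fun m _ i => (c1 i).continuous.integrable_of_hasCompactSupport (c2 i)
    simp only [divX, Finset.mul_sum]
    rw [integral_finsetSum _ fun i _ =>
      integrableOn_mul_euclideanDiv_smul hu (hX i) (c1 i) (c2 i) (c3 i), ← Finset.sum_neg_distrib]
    refine Finset.sum_congr rfl fun i _ => ?_
    rw [integral_lsmul_toSignedMeasure_sub (hi _ inferInstance i) (hi _ inferInstance i),
      h i _ (c1 i) (c2 i) (c3 i)]

/-- For a family of vector fields that depends linearly on a parameter `v`, finite variation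
along a basis of parameters amounts to finite variation along each of them. -/
lemma hasFiniteHVariation_basis_iff {V : Type*} [AddCommGroup V] [Module ℝ V]
    (b : Module.Basis ι ℝ V) {Z : V → E → E} {Ω : Set E} {u : E → ℝ}
    (hu : LocallyIntegrableOn u Ω) (hZ : ∀ v, ContDiff ℝ 1 (Z v))
    (hadd : ∀ v w, Z (v + w) = fun x => Z v x + Z w x)
    (hsmul : ∀ (c : ℝ) v, Z (c • v) = fun x => c • Z v x) :
    HasFiniteHVariation (fun i => Z (b i)) Ω u ↔ ∀ v, HasFiniteFieldVariation (Z v) Ω u := by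
  rw [hasFiniteHVariation_iff hu fun i => hZ _]
  refine ⟨fun h v => ?_, fun h i => h _⟩
  -- The admissible parameters form a subspace, which contains a basis and hence is everything.
  let S : Submodule ℝ V :=
    { carrier := {v | HasFiniteFieldVariation (Z v) Ω u}
      add_mem' := fun {v w} hv hw => by
        rw [mem_ofPred_eq, hadd]
        exact hv.add hu (hZ v) (hZ w) hw
      zero_mem' := by
        have h0 : Z 0 = fun x => (0 : ℝ) • Z 0 x := by rw [← hsmul, zero_smul]
        rw [mem_ofPred_eq, h0]
        exact ⟨0, 0, inferInstance, inferInstance, fun φ _ _ _ => by simp [euclideanDiv]⟩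
      smul_mem' := fun c v hv => by
        rw [mem_ofPred_eq, hsmul]
        exact HasFiniteFieldVariation.const_smul c hv }
  have hS : Submodule.span ℝ (range b) ≤ S := by
    rw [Submodule.span_le]
    rintro _ ⟨i, rfl⟩
    exact h i
  exact hS (b.span_eq ▸ Submodule.mem_top)

end FieldVariation

/-! ### Subgraphs -/

section Subgraph

variable {E : Type*}

/-- The characteristic function of the subgraph `{(x, t) | t < v x}`. -/
noncomputable def subgraphIndicator (v : E → ℝ) : E × ℝ → ℝ :=
  {p : E × ℝ | p.2 < v p.1}.indicator fun _ => 1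

lemma subgraphIndicator_mul_eq_indicator (v : E → ℝ) (g : E × ℝ → ℝ) (x : E) :
    (fun t => subgraphIndicator v (x, t) * g (x, t)) = (Iio (v x)).indicator fun t => g (x, t) := by
  ext t
  by_cases h : t < v x <;> simp [subgraphIndicator, h]

lemma measurable_subgraphIndicator [MeasurableSpace E] {v : E → ℝ} (hv : Measurable v) :
    Measurable (subgraphIndicator v) :=
  measurable_const.indicator (measurableSet_lt measurable_snd (hv.comp measurable_fst))

lemma norm_subgraphIndicator_le (v : E → ℝ) (p : E × ℝ) : ‖subgraphIndicator v p‖ ≤ 1 := by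
  by_cases h : p.2 < v p.1 <;> simp [subgraphIndicator, h]

lemma integrable_subgraphIndicator_mul [MeasurableSpace E] {μ : Measure (E × ℝ)} {v : E → ℝ}
    (hv : Measurable v) {g : E × ℝ → ℝ} (hg : Integrable g μ) :
    Integrable (fun p => subgraphIndicator v p * g p) μ :=
  hg.bdd_mul (measurable_subgraphIndicator hv).aestronglyMeasurable
    (Eventually.of_forall (norm_subgraphIndicator_le v))

/-- Fubini in the vertical variable. The half-line is closed at the cost of a null set, to match the
fundamental theorem of calculus on `Iic`. -/
lemma setIntegral_subgraphIndicator_mul [MeasureSpace E] [SigmaFinite (volume : Measure E)]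
    {v : E → ℝ} (hv : Measurable v) (Ω : Set E) {g : E × ℝ → ℝ} (hg : Integrable g) :
    ∫ p in Ω ×ˢ univ, subgraphIndicator v p * g p = ∫ x in Ω, ∫ t in Iic (v x), g (x, t) := by
  rw [Measure.volume_eq_prod, setIntegral_prod]
  · refine integral_congr_ae (Eventually.of_forall fun x => ?_)
    simp only [Measure.restrict_univ]
    rw [subgraphIndicator_mul_eq_indicator, integral_indicator measurableSet_Iio,
      integral_Iic_eq_integral_Iio]
  · exact (integrable_subgraphIndicator_mul hv hg).integrableOn

lemma integrable_integral_Iic [MeasureSpace E] [SigmaFinite (volume : Measure E)]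
    {v : E → ℝ} (hv : Measurable v) {g : E × ℝ → ℝ} (hg : Integrable g) :
    Integrable fun x => ∫ t in Iic (v x), g (x, t) := by
  refine (integrable_subgraphIndicator_mul hv hg).integral_prod_left.congr
    (Eventually.of_forall fun x => ?_)
  simp only
  rw [subgraphIndicator_mul_eq_indicator, integral_indicator measurableSet_Iio,
    integral_Iic_eq_integral_Iio]

end Subgraph

lemma hasDerivAt_vertical {E : Type*} [NormedAddCommGroup E] [NormedSpace ℝ E]
    {φ : E × ℝ → ℝ} (hφ : ContDiff ℝ 1 φ) (x : E) (t : ℝ) :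
    HasDerivAt (fun s => φ (x, s)) (fderiv ℝ φ (x, t) (0, 1)) t := by
  have h := (hφ.differentiable (by simp) (x, t)).hasFDerivAt
  exact h.comp_hasDerivAt t ((hasDerivAt_const t x).prodMk (hasDerivAt_id t))

lemma hasCompactSupport_slice {E : Type*} [TopologicalSpace E]
    {F : Type*} [Zero F] {φ : E × ℝ → F} (hφ : HasCompactSupport φ)
    (x : E) : HasCompactSupport fun s => φ (x, s) := by
  refine HasCompactSupport.intro (IsCompact.image hφ continuous_snd) fun s hs => ?_
  by_contra h
  exact hs ⟨(x, s), subset_tsupport _ h, rfl⟩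

lemma integral_Iic_fderiv_vertical {E : Type*} [NormedAddCommGroup E] [NormedSpace ℝ E]
    {φ : E × ℝ → ℝ} (hφ : ContDiff ℝ 1 φ) (hc : HasCompactSupport φ) (x : E) (s : ℝ) :
    ∫ t in Iic s, fderiv ℝ φ (x, t) (0, 1) = φ (x, s) := by
  have h := HasCompactSupport.integral_Iic_deriv_eq (f := fun t => φ (x, t))
    (hφ.comp (contDiff_const.prodMk contDiff_id)) (hasCompactSupport_slice hc x) s
  rw [← h]
  exact integral_congr_ae (Eventually.of_forall fun t => (hasDerivAt_vertical hφ x t).deriv.symm)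

/-! ### Vertical variation, and descent from the subgraph to the function -/

section SubgraphVariation

variable {E : Type*} [NormedAddCommGroup E] [NormedSpace ℝ E] [FiniteDimensional ℝ E]
  [MeasureSpace E] [BorelSpace E] [(volume : Measure E).IsAddHaarMeasure]

/-- The subgraph of a function over a set of finite volume has finite variation in the vertical
direction. -/
lemma hasFiniteFieldVariation_vertical {Ω : Set E} (hΩ : volume Ω ≠ ⊤) {v : E → ℝ}
    (hv : Measurable v) :
    HasFiniteFieldVariation (fun _ => ((0, 1) : E × ℝ)) (Ω ×ˢ univ) (subgraphIndicator v) := by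
  have hfin : IsFiniteMeasure (volume.restrict Ω) := ⟨by simpa using hΩ.lt_top⟩
  have hm : Measurable fun x => (x, v x) := measurable_id.prodMk hv
  -- The characteristic function drops from 1 to 0 as `t` crosses the graph, so the vertical
  -- derivative is purely negative.
  refine ⟨0, (volume.restrict Ω).map fun x => (x, v x), inferInstance, inferInstance,
    fun φ h1 h2 h3 => ?_⟩
  have hdiv : ∀ p, euclideanDiv (fun q => φ q • ((0, 1) : E × ℝ)) p = fderiv ℝ φ p (0, 1) := by
    intro p
    rw [euclideanDiv_smul (h1.differentiable (by simp) p) (differentiableAt_const _)]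
    simp [euclideanDiv]
  have hg : Integrable fun p => fderiv ℝ φ p (0, 1) :=
    ((h1.continuous_fderiv (by simp)).clm_apply continuous_const).integrable_of_hasCompactSupport
      (h2.fderiv_apply ℝ _)
  simp_rw [hdiv]
  rw [setIntegral_subgraphIndicator_mul hv Ω hg, integral_map hm.aemeasurable
    h1.continuous.aestronglyMeasurable]
  simp [integral_Iic_fderiv_vertical h1 h2]

/-- If the subgraph of `v` has finite variation along the lift of `Z`, then `v` has finite
variation along `Z`. -/
lemma HasFiniteFieldVariation.of_subgraph {Ω : Set E} {v : E → ℝ} (hv : Measurable v)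
    (hvΩ : IntegrableOn v Ω) {Z : E → E} (hZ : ContDiff ℝ 1 Z)
    (h : HasFiniteFieldVariation (horizontalLift Z) (Ω ×ˢ univ) (subgraphIndicator v)) :
    HasFiniteFieldVariation Z Ω v := by
  obtain ⟨μ, ν, hμ, hν, h⟩ := h
  refine ⟨μ.map Prod.fst, ν.map Prod.fst, inferInstance, inferInstance, fun φ h1 h2 h3 => ?_⟩
  -- Vertical cut-offs equal to 1 on `[-(k+1), k+1]`: the pulled-back test function `φ(x)` is not
  -- compactly supported in `E × ℝ`.
  let b : ℕ → ContDiffBump (0 : ℝ) := fun k => ⟨k + 1, k + 2, by positivity, by linarith⟩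
  have hb : ∀ s : ℝ, ∀ᶠ k in atTop, ∀ t, |t| ≤ |s| → b k t = 1 := by
    intro s
    obtain ⟨n, hn⟩ := exists_nat_ge |s|
    filter_upwards [eventually_ge_atTop n] with k hk t ht
    refine (b k).one_of_mem_closedBall ?_
    have : (n : ℝ) ≤ k := by exact_mod_cast hk
    simp only [Metric.mem_closedBall, dist_zero_right, Real.norm_eq_abs, b]
    linarith
  have hφZ : ContDiff ℝ 1 fun y => φ y • Z y := h1.smul hZ
  set d := euclideanDiv fun y => φ y • Z y with hd
  have hdcont : Continuous d := continuous_euclideanDiv_smul h1 hZ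
  have hdc : HasCompactSupport d := hasCompactSupport_euclideanDiv_smul h2
  have hd0 : ∫ x in Ω, d x = 0 := by
    rw [setIntegral_eq_integral_of_forall_compl_eq_zero, hd]
    · exact integral_euclideanDiv_eq_zero _ hφZ h2.smul_right
    · exact fun x hx => euclideanDiv_eq_zero_of_notMem_tsupport fun hx' => hx (h3 hx')
  have hΦ1 : ∀ k, ContDiff ℝ 1 fun p : E × ℝ => φ p.1 * b k p.2 := fun k =>
    (h1.comp contDiff_fst).mul ((b k).contDiff.comp contDiff_snd)
  have hΦs : ∀ k, tsupport (fun p : E × ℝ => φ p.1 * b k p.2) ⊆ tsupport φ ×ˢ tsupport (b k) := by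
    refine fun k => closure_minimal (fun p hp => ?_)
      ((isClosed_tsupport _).prod (isClosed_tsupport _))
    exact ⟨subset_tsupport _ (left_ne_zero_of_mul hp), subset_tsupport _ (right_ne_zero_of_mul hp)⟩
  have hΦc : ∀ k, HasCompactSupport fun p : E × ℝ => φ p.1 * b k p.2 := fun k =>
    (h2.isCompact.prod (b k).hasCompactSupport.isCompact).of_isClosed_subset
      (isClosed_tsupport _) (hΦs k)
  have hdiv : ∀ k p, euclideanDiv (fun q : E × ℝ => (φ q.1 * b k q.2) • horizontalLift Z q) p
      = d p.1 * b k p.2 := by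
    intro k p
    have e1 : HasFDerivAt (fun q : E × ℝ => φ q.1)
        ((fderiv ℝ φ p.1).comp (ContinuousLinearMap.fst ℝ E ℝ)) p :=
      HasFDerivAt.comp (f := fun y : E × ℝ => y.1) p
        (h1.differentiable (by simp) p.1).hasFDerivAt hasFDerivAt_fst
    have e2 : HasFDerivAt (fun q : E × ℝ => b k q.2)
        ((fderiv ℝ (b k) p.2).comp (ContinuousLinearMap.snd ℝ E ℝ)) p :=
      HasFDerivAt.comp (f := fun y : E × ℝ => y.2) p
        (((b k).contDiff (n := 1)).differentiable (by simp) p.2).hasFDerivAt hasFDerivAt_snd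
    rw [euclideanDiv_smul_horizontalLift (hΦ1 k |>.differentiable (by simp) p)
      (hZ.differentiable (by simp) _), (e1.fun_mul e2).fderiv, hd,
      euclideanDiv_smul (h1.differentiable (by simp) _) (hZ.differentiable (by simp) _)]
    simp
    ring
  have key : ∀ k, ∫ p, φ p.1 * b k p.2 ∂μ - ∫ p, φ p.1 * b k p.2 ∂ν
      = - ∫ x in Ω, d x * ∫ t in (0)..(v x), b k t := by
    intro k
    rw [h _ (hΦ1 k) (hΦc k) ((hΦs k).trans (prod_mono h3 (subset_univ _)))]
    simp_rw [hdiv k]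
    have hbi : Integrable (b k) := (b k).integrable
    have hdi : Integrable fun p : E × ℝ => d p.1 * b k p.2 :=
      (hdcont.integrable_of_hasCompactSupport hdc).mul_prod hbi
    rw [setIntegral_subgraphIndicator_mul hv Ω hdi]
    -- The integral of `b k` over `(-∞, 0]` grows without bound in `k`, but it multiplies `∫ d = 0`;
    -- removing it leaves a quantity bounded by `|v x|`.
    have e : ∀ x, d x * ∫ t in (0)..(v x), b k t
        = (∫ t in Iic (v x), d x * b k t) - d x * ∫ t in Iic 0, b k t := by
      intro x
      rw [← intervalIntegral.integral_Iic_sub_Iic hbi.integrableOn hbi.integrableOn,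
        integral_const_mul]
      ring
    simp_rw [e]
    rw [integral_sub, integral_mul_const, hd0, zero_mul, sub_zero]
    · exact (integrable_integral_Iic hv hdi).integrableOn
    · exact ((hdcont.integrable_of_hasCompactSupport hdc).mul_const _).integrableOn
  have lim : ∀ m : Measure (E × ℝ), IsFiniteMeasure m →
      Tendsto (fun k => ∫ p, φ p.1 * b k p.2 ∂m) atTop (𝓝 (∫ x, φ x ∂(m.map Prod.fst))) := by
    intro m _
    rw [integral_map measurable_fst.aemeasurable h1.continuous.aestronglyMeasurable]
    have hφi : Integrable (fun p : E × ℝ => φ p.1) m := by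
      have : Integrable φ (m.map Prod.fst) := h1.continuous.integrable_of_hasCompactSupport h2
      exact this.comp_measurable measurable_fst
    refine tendsto_integral_of_dominated_convergence (fun p => ‖φ p.1‖) (fun k => ?_) hφi.norm
      (fun k => Eventually.of_forall fun p => ?_) (Eventually.of_forall fun p => ?_)
    · exact (hΦ1 k).continuous.aestronglyMeasurable
    · rw [norm_mul]
      refine mul_le_of_le_one_right (norm_nonneg _) ?_
      rw [Real.norm_of_nonneg (b k).nonneg]
      exact (b k).le_one
    · refine tendsto_const_nhds.congr' ?_
      filter_upwards [hb p.2] with k hk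
      rw [hk _ le_rfl, mul_one]
  have lim2 : Tendsto (fun k => - ∫ x in Ω, d x * ∫ t in (0)..(v x), b k t) atTop
      (𝓝 (- ∫ x in Ω, v x * d x)) := by
    obtain ⟨C, hC⟩ := hdcont.bounded_above_of_compact_support hdc
    refine (tendsto_integral_of_dominated_convergence (fun x => C * ‖v x‖) (fun k => ?_)
      (hvΩ.norm.const_mul C) (fun k => Eventually.of_forall fun x => ?_)
      (Eventually.of_forall fun x => ?_)).neg
    · have hprim : Continuous fun s => ∫ t in (0)..s, b k t :=
        intervalIntegral.continuous_primitive
          (fun _ _ => (b k).continuous.intervalIntegrable _ _) 0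
      exact (hdcont.measurable.mul (hprim.measurable.comp hv)).aestronglyMeasurable
    · rw [norm_mul]
      refine mul_le_mul (hC x) ?_ (norm_nonneg _) ((norm_nonneg _).trans (hC x))
      refine (intervalIntegral.norm_integral_le_of_norm_le_const (C := 1) fun t _ => ?_).trans
        (by simp)
      rw [Real.norm_of_nonneg (b k).nonneg]
      exact (b k).le_one
    · refine tendsto_const_nhds.congr' ?_
      filter_upwards [hb (v x)] with k hk
      rw [mul_comm, intervalIntegral.integral_congr (g := fun _ => 1)]
      · simp
      · intro t ht
        refine hk t ?_
        have := abs_sub_left_of_mem_uIcc ht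
        simpa using this
  refine tendsto_nhds_unique (((lim μ hμ).sub (lim ν hν)).congr fun k => key k) lim2

end SubgraphVariation

/-! ### Weak compactness of bounded families of measures -/

section WeakCompactness

open scoped CompactlySupported NNReal

variable {X : Type*} [TopologicalSpace X] [T2Space X] [LocallyCompactSpace X]
  [SigmaCompactSpace X] [MeasurableSpace X] [BorelSpace X]

/-- Along an ultrafilter, measures of bounded mass converge vaguely to a finite measure. -/
lemma exists_finite_measure_tendsto_integral {ι : Type*} (U : Ultrafilter ι) (m : ι → Measure X)
    [∀ k, IsFiniteMeasure (m k)] (C : ℝ≥0) (hm : ∀ k, m k univ ≤ C) :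
    ∃ μ : Measure X, IsFiniteMeasure μ ∧ ∀ f : X → ℝ, Continuous f → HasCompactSupport f →
      Tendsto (fun k => ∫ x, f x ∂(m k)) U (𝓝 (∫ x, f x ∂μ)) := by
  have hbound : ∀ (f : X → ℝ) (B : ℝ), (∀ x, ‖f x‖ ≤ B) → 0 ≤ B →
      ∀ k, ‖∫ x, f x ∂(m k)‖ ≤ B * C := by
    intro f B hB hB0 k
    refine (norm_integral_le_of_norm_le_const (Eventually.of_forall hB)).trans ?_
    gcongr
    exact ENNReal.toReal_le_coe_of_le_coe (hm k)
  have hi : ∀ (f : C_c(X, ℝ)) k, Integrable f (m k) := fun f k =>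
    f.continuous.integrable_of_hasCompactSupport f.hasCompactSupport
  have hex : ∀ f : C_c(X, ℝ), ∃ L, Tendsto (fun k => ∫ x, f x ∂(m k)) U (𝓝 L) := by
    intro f
    obtain ⟨B, hB⟩ := f.continuous.bounded_above_of_compact_support f.hasCompactSupport
    have hB' : ∀ x, ‖f x‖ ≤ max B 0 := fun x => (hB x).trans (le_max_left _ _)
    -- The integrals stay in a fixed compact interval, so they converge along the ultrafilter for
    -- every test function at once, with no subsequence to extract.
    obtain ⟨L, -, hL⟩ := (isCompact_closedBall (0 : ℝ) (max B 0 * C)).ultrafilter_le_nhds'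
      (U.map fun k => ∫ x, f x ∂(m k))
      (Eventually.of_forall (f := (U : Filter ι)) fun k => by
        simpa using hbound f _ hB' (le_max_right _ _) k)
    exact ⟨L, hL⟩
  choose Λ hΛ using hex
  let Λ' : C_c(X, ℝ) →ₚ[ℝ] ℝ := PositiveLinearMap.mk₀
    { toFun := Λ
      map_add' := fun f g => by
        refine tendsto_nhds_unique (hΛ (f + g)) (((hΛ f).add (hΛ g)).congr fun k => ?_)
        simp [integral_add (hi f k) (hi g k)]
      map_smul' := fun c f => by
        refine tendsto_nhds_unique (hΛ (c • f)) (((hΛ f).const_mul c).congr fun k => ?_)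
        simp [integral_const_mul] }
    fun f hf => ge_of_tendsto' (hΛ f) fun k => integral_nonneg hf
  -- Mass may escape to infinity, but none is created: each compact set is dominated by a test
  -- function with values in `[0, 1]`, and compact sets exhaust the space.
  have hfin : RealRMK.rieszMeasure Λ' univ ≤ C := by
    have hK : ∀ n, RealRMK.rieszMeasure Λ' (compactCovering X n) ≤ C := by
      intro n
      obtain ⟨f, h1, -, h2, h3⟩ := exists_continuous_one_zero_of_isCompact
        (isCompact_compactCovering X n) isClosed_empty (disjoint_empty _)
      refine (RealRMK.rieszMeasure_le_of_eq_one Λ' (f := ⟨f, h2⟩) (fun x => (h3 x).1)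
        (isCompact_compactCovering X n) h1).trans ?_
      rw [← ENNReal.ofReal_coe_nnreal]
      refine ENNReal.ofReal_le_ofReal (le_of_tendsto' (hΛ ⟨f, h2⟩) fun k => ?_)
      refine (Real.le_norm_self _).trans ((hbound f 1 (fun x => ?_) zero_le_one k).trans_eq
        (one_mul _))
      rw [Real.norm_of_nonneg (h3 x).1]
      exact (h3 x).2
    have hmono : Monotone (compactCovering X) := fun a b h => compactCovering_subset X h
    rw [← iUnion_compactCovering, hmono.measure_iUnion]
    exact iSup_le hK
  refine ⟨RealRMK.rieszMeasure Λ', ⟨hfin.trans_lt ENNReal.coe_lt_top⟩, fun f hf hc => ?_⟩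
  have := RealRMK.integral_rieszMeasure Λ' ⟨⟨f, hf⟩, hc⟩
  have h2 : ∫ x, f x ∂(RealRMK.rieszMeasure Λ') = Λ ⟨⟨f, hf⟩, hc⟩ := this
  rw [h2]
  exact hΛ ⟨⟨f, hf⟩, hc⟩

end WeakCompactness

/-! ### The subgraph of a smooth function -/

section SmoothSubgraph

variable {E : Type*} [NormedAddCommGroup E] [NormedSpace ℝ E] [FiniteDimensional ℝ E]
  [MeasureSpace E] [BorelSpace E] [(volume : Measure E).IsAddHaarMeasure]

/-- The shear `(x, s) ↦ (x, v x + s)`. -/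
def shearHomeomorph {E : Type*} [TopologicalSpace E] {v : E → ℝ} (hv : Continuous v) :
    E × ℝ ≃ₜ E × ℝ where
  toFun p := (p.1, v p.1 + p.2)
  invFun p := (p.1, p.2 - v p.1)
  left_inv p := by simp
  right_inv p := by simp
  continuous_toFun := by fun_prop
  continuous_invFun := by fun_prop

lemma hasCompactSupport_comp_graph {E : Type*} [TopologicalSpace E] [T2Space E] {φ : E × ℝ → ℝ}
    (hc : HasCompactSupport φ) (w : E → ℝ) : HasCompactSupport fun x => φ (x, w x) := by
  refine HasCompactSupport.intro (IsCompact.image hc continuous_fst) fun x hx => ?_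
  by_contra h
  exact hx ⟨_, subset_tsupport _ h, rfl⟩

/-- The shear flattens the subgraph to the half-space `s ≤ 0`. After the exchange of integrals, each
level is a vertical translate of the graph. -/
lemma integral_Iic_integral_shear {g : E × ℝ → ℝ} (hg : Continuous g) (hc : HasCompactSupport g)
    {v : E → ℝ} (hv : Continuous v) :
    ∫ x, ∫ t in Iic (v x), g (x, t) = ∫ s in Iic 0, ∫ x, g (x, v x + s) := by
  have hi : Integrable (fun p : E × ℝ => g (p.1, v p.1 + p.2)) :=
    (hg.comp (shearHomeomorph hv).continuous).integrable_of_hasCompactSupport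
      (hc.comp_homeomorph (shearHomeomorph hv))
  have h : ∀ x, ∫ t in Iic (v x), g (x, t) = ∫ s in Iic 0, g (x, v x + s) := by
    intro x
    have := (measurePreserving_add_left volume (v x)).setIntegral_preimage_emb
      (measurableEmbedding_addLeft (v x)) (fun t => g (x, t)) (Iic (v x))
    rw [← this]
    simp
  simp_rw [h]
  rw [integral_integral_swap]
  have := hi.integrableOn (s := univ ×ˢ Iic 0)
  rwa [IntegrableOn, Measure.volume_eq_prod, ← Measure.prod_restrict, Measure.restrict_univ] at this

/-- The derivative of the subgraph of a smooth function `v` along the lift of `Z` is carried by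
the graph of `v`, with density `Z v`. -/
lemma integral_Iic_euclideanDiv_smul_horizontalLift {φ : E × ℝ → ℝ} (hφ : ContDiff ℝ 1 φ)
    (hc : HasCompactSupport φ) {Z : E → E} (hZ : ContDiff ℝ 1 Z) {v : E → ℝ}
    (hv : ContDiff ℝ 1 v) :
    ∫ x, ∫ t in Iic (v x), euclideanDiv (fun q => φ q • horizontalLift Z q) (x, t)
      = - ∫ x, φ (x, v x) * fderiv ℝ v x (Z x) := by
  have hZ' := contDiff_horizontalLift hZ
  set w : E → ℝ := fun x => fderiv ℝ v x (Z x) with hw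
  have hwc : Continuous w := (hv.continuous_fderiv (by simp)).clm_apply hZ.continuous
  have hdφ : Continuous fun p => fderiv ℝ φ p (0, 1) :=
    (hφ.continuous_fderiv (by simp)).clm_apply continuous_const
  have hdφc : HasCompactSupport fun p => fderiv ℝ φ p (0, 1) := hc.fderiv_apply ℝ _
  rw [integral_Iic_integral_shear (continuous_euclideanDiv_smul hφ hZ')
    (hasCompactSupport_euclideanDiv_smul hc) hv.continuous]
  have key : ∀ s : ℝ, ∫ x, euclideanDiv (fun q => φ q • horizontalLift Z q) (x, v x + s)
      = - ∫ x, fderiv ℝ φ (x, v x + s) (0, 1) * w x := by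
    intro s
    have hγ : ContDiff ℝ 1 fun x => (x, v x + s) := contDiff_id.prodMk (hv.add contDiff_const)
    have hsl := hasCompactSupport_comp_graph hc fun x => v x + s
    -- The divergence theorem on the translated graph: by the chain rule the divergence splits into
    -- the horizontal one and `∂_t φ · Z v`. The factor `Z v` does not depend on `s`, so integrating
    -- in `s` turns `∂_t φ` back into `φ`.
    have h0 := integral_euclideanDiv_eq_zero (volume : Measure E)
      (F := fun x => φ (x, v x + s) • Z x) ((hφ.comp hγ).smul hZ) hsl.smul_right
    have e : ∀ x, euclideanDiv (fun y => φ (y, v y + s) • Z y) x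
        = euclideanDiv (fun q => φ q • horizontalLift Z q) (x, v x + s)
          + fderiv ℝ φ (x, v x + s) (0, 1) * w x := by
      intro x
      have hd : HasFDerivAt (fun y => (y, v y + s))
          ((ContinuousLinearMap.id ℝ E).prod (fderiv ℝ v x)) x :=
        (hasFDerivAt_id x).prodMk ((hv.differentiable (by simp) x).hasFDerivAt.add_const s)
      have hd2 : HasFDerivAt (fun y => φ (y, v y + s))
          ((fderiv ℝ φ (x, v x + s)).comp ((ContinuousLinearMap.id ℝ E).prod (fderiv ℝ v x))) x :=
        (hφ.differentiable (by simp) (x, v x + s)).hasFDerivAt.comp x hd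
      rw [euclideanDiv_smul hd2.differentiableAt (hZ.differentiable (by simp) x), hd2.fderiv,
        euclideanDiv_smul_horizontalLift (hφ.differentiable (by simp) _)
          (hZ.differentiable (by simp) _)]
      have : ((Z x, w x) : E × ℝ) = (Z x, 0) + w x • (0, 1) := by simp
      simp only [ContinuousLinearMap.comp_apply, ContinuousLinearMap.prod_apply,
        ContinuousLinearMap.id_apply]
      change _ + fderiv ℝ φ (x, v x + s) (Z x, w x) = _
      rw [this, map_add, map_smul, smul_eq_mul]
      ring
    simp_rw [e] at h0
    rw [integral_add] at h0
    · linarith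
    · refine ((continuous_euclideanDiv_smul hφ hZ').comp
        hγ.continuous).integrable_of_hasCompactSupport ?_
      exact hasCompactSupport_comp_graph (hasCompactSupport_euclideanDiv_smul hc) fun x => v x + s
    · exact ((hdφ.comp hγ.continuous).mul hwc).integrable_of_hasCompactSupport
        (hasCompactSupport_comp_graph hdφc fun x => v x + s).mul_right
  simp_rw [key]
  rw [integral_neg, ← integral_Iic_integral_shear (g := fun p => fderiv ℝ φ p (0, 1) * w p.1)
    (by fun_prop) hdφc.mul_right hv.continuous]
  simp_rw [integral_mul_const, integral_Iic_fderiv_vertical hφ hc, hw]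

end SmoothSubgraph

/-! ### Mollification -/

lemma MeasureTheory.Integrable.mul_of_hasCompactSupport {E : Type*} [TopologicalSpace E]
    [MeasurableSpace E] [OpensMeasurableSpace E] {μ : Measure E} {f g : E → ℝ}
    (hg : Integrable g μ) (hf : Continuous f) (hc : HasCompactSupport f) :
    Integrable (fun x => f x * g x) μ := by
  obtain ⟨C, hC⟩ := hf.bounded_above_of_compact_support hc
  exact hg.bdd_mul hf.aestronglyMeasurable (Eventually.of_forall hC)

section Mollification

open scoped NNReal ENNReal Convolution

variable {E : Type*} [NormedAddCommGroup E] [NormedSpace ℝ E] [FiniteDimensional ℝ E]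

/-- The bump functions of radii `r` and `2 * r`. -/
def scaledBump (E : Type*) [NormedAddCommGroup E] {r : ℝ} (hr : 0 < r) : ContDiffBump (0 : E) :=
  ⟨r, 2 * r, hr, by linarith⟩

lemma scaledBump_apply {r : ℝ} (hr : 0 < r) (z : E) :
    scaledBump E hr z = scaledBump E one_pos (r⁻¹ • z) := by
  have h : 2 * r / r = 2 := by field_simp
  simp [ContDiffBump.apply, scaledBump, h]

lemma fderiv_scaledBump {r : ℝ} (hr : 0 < r) (z : E) :
    fderiv ℝ (scaledBump E hr) z = r⁻¹ • fderiv ℝ (scaledBump E one_pos) (r⁻¹ • z) := by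
  rw [← fderiv_comp_smul]
  congr 1
  ext z
  exact scaledBump_apply hr z

variable [MeasureSpace E] [BorelSpace E] [(volume : Measure E).IsAddHaarMeasure]

/-- The first moment of the gradient of the standard mollifier does not depend on the scale. -/
lemma integral_norm_mul_norm_fderiv_normed_scaledBump {r : ℝ} (hr : 0 < r) :
    ∫ z, ‖z‖ * ‖fderiv ℝ ((scaledBump E hr).normed volume) z‖
      = (∫ z, ‖z‖ * ‖fderiv ℝ (scaledBump E one_pos) z‖) / ∫ z, scaledBump E one_pos z := by
  have h1 : ∫ z, scaledBump E hr z
      = r ^ Module.finrank ℝ E * ∫ z, scaledBump E one_pos z := by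
    simp_rw [scaledBump_apply hr]
    rw [Measure.integral_comp_inv_smul, smul_eq_mul, abs_of_pos (by positivity)]
  have hpos : 0 < ∫ z, scaledBump E one_pos z := (scaledBump E one_pos).integral_pos
  have h2 : ∀ z, ‖z‖ * ‖fderiv ℝ ((scaledBump E hr).normed volume) z‖
      = (∫ z, scaledBump E hr z)⁻¹ * (fun z : E => ‖z‖ * ‖fderiv ℝ (scaledBump E one_pos) z‖)
        (r⁻¹ • z) := by
    intro z
    have e : (scaledBump E hr).normed volume
        = fun z => (∫ z, scaledBump E hr z)⁻¹ * scaledBump E hr z := by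
      ext z
      rw [ContDiffBump.normed_def, div_eq_inv_mul]
    rw [e, fderiv_const_mul ((scaledBump E hr).contDiff (n := 1) |>.differentiable (by simp) z),
      fderiv_scaledBump hr]
    simp only [norm_smul, norm_inv, Real.norm_eq_abs]
    rw [abs_of_pos hr, abs_of_pos (scaledBump E hr).integral_pos]
    ring
  simp_rw [h2]
  rw [integral_const_mul, Measure.integral_comp_inv_smul (volume : Measure E)
    (fun z : E => ‖z‖ * ‖fderiv ℝ (scaledBump E one_pos) z‖) r, h1, smul_eq_mul,
    abs_of_pos (by positivity)]
  field_simp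

lemma fderiv_convolution_apply {ρ v : E → ℝ} (hρ : ContDiff ℝ 1 ρ) (hc : HasCompactSupport ρ)
    (hv : LocallyIntegrable v) (x w : E) :
    fderiv ℝ (ρ ⋆[ContinuousLinearMap.lsmul ℝ ℝ, volume] v) x w
      = ∫ y, fderiv ℝ ρ (x - y) w * v y := by
  rw [(hc.hasFDerivAt_convolution_left _ hρ hv x).fderiv, convolution_eq_swap,
    ContinuousLinearMap.integral_apply]
  · simp
  · exact ((hc.fderiv ℝ).convolutionExists_left _ (hρ.continuous_fderiv (by simp)) hv
      x).integrable_swap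

/-- Tonelli and translation invariance. The measure `m` is general because the estimate needs both
Lebesgue measure and the two parts of the derivative. -/
lemma lintegral_lintegral_mul_comp_sub {m : Measure E} [SFinite m] {h w : E → ℝ≥0∞}
    (hh : Measurable h) (hw : Measurable w) :
    ∫⁻ x, ∫⁻ y, w y * h (x - y) ∂m = (∫⁻ z, h z) * ∫⁻ y, w y ∂m := by
  rw [lintegral_lintegral_swap (by fun_prop)]
  have : ∀ y, ∫⁻ x, w y * h (x - y) = w y * ∫⁻ z, h z := by
    intro y
    rw [lintegral_const_mul _ (by fun_prop), lintegral_sub_right_eq_self h y]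
  simp_rw [this]
  rw [lintegral_mul_const _ hw, mul_comm]

/-- **Friedrichs' estimate**: the derivative of a mollification along `Z` is bounded in `L¹`. -/
lemma setLIntegral_enorm_fderiv_convolution_le {Z : E → E} (hZ : ContDiff ℝ 1 Z) {Ω : Set E}
    {L M : ℝ≥0} (hL : LipschitzOnWith L Z Ω) (hM : ∀ x ∈ Ω, ‖euclideanDiv Z x‖ ≤ M)
    {v : E → ℝ} (hvm : Measurable v) (hv : Integrable v) (hv0 : ∀ x ∉ Ω, v x = 0)
    {μ ν : Measure E} [IsFiniteMeasure μ] [IsFiniteMeasure ν]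
    (hμν : ∀ φ : E → ℝ, ContDiff ℝ 1 φ → HasCompactSupport φ → tsupport φ ⊆ Ω →
      ∫ x, φ x ∂μ - ∫ x, φ x ∂ν = - ∫ x in Ω, v x * euclideanDiv (fun y => φ y • Z y) x)
    {ρ : E → ℝ} (hρ : ContDiff ℝ 1 ρ) (hρc : HasCompactSupport ρ)
    {K : Set E} (hK : MeasurableSet K)
    (hKΩ : ∀ x ∈ K, x ∈ Ω ∧ tsupport (fun y => ρ (x - y)) ⊆ Ω) :
    ∫⁻ x in K, ‖fderiv ℝ (ρ ⋆[ContinuousLinearMap.lsmul ℝ ℝ, volume] v) x (Z x)‖ₑ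
      ≤ (∫⁻ z, (L * (‖z‖ₑ * ‖fderiv ℝ ρ z‖ₑ) + M * ‖ρ z‖ₑ)) * (∫⁻ y, ‖v y‖ₑ)
        + (∫⁻ z, ‖ρ z‖ₑ) * μ univ + (∫⁻ z, ‖ρ z‖ₑ) * ν univ := by
  set h : E → ℝ≥0∞ := fun z => L * (‖z‖ₑ * ‖fderiv ℝ ρ z‖ₑ) + M * ‖ρ z‖ₑ with hh
  have hdρ : Continuous (fderiv ℝ ρ) := hρ.continuous_fderiv (by simp)
  have hρm : Measurable fun z => ‖ρ z‖ₑ := hρ.continuous.enorm.measurable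
  have hhm : Measurable h := by
    have := hdρ.enorm.measurable
    fun_prop
  have pointwise : ∀ x ∈ K,
      ‖fderiv ℝ (ρ ⋆[ContinuousLinearMap.lsmul ℝ ℝ, volume] v) x (Z x)‖ₑ
        ≤ (∫⁻ y, ‖v y‖ₑ * h (x - y)) + (∫⁻ y, ‖ρ (x - y)‖ₑ ∂μ) + ∫⁻ y, ‖ρ (x - y)‖ₑ ∂ν := by
    intro x hx
    obtain ⟨hxΩ, hsupp⟩ := hKΩ x hx
    have hφ : ContDiff ℝ 1 fun y => ρ (x - y) := hρ.comp (contDiff_const.sub contDiff_id)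
    have hφc : HasCompactSupport fun y => ρ (x - y) :=
      hρc.comp_homeomorph (Homeomorph.subLeft x)
    have hdiv : ∀ y, euclideanDiv (fun y => ρ (x - y) • Z y) y
        = ρ (x - y) * euclideanDiv Z y - fderiv ℝ ρ (x - y) (Z y) := by
      intro y
      have hd : HasFDerivAt (fun y => ρ (x - y))
          ((fderiv ℝ ρ (x - y)).comp (-ContinuousLinearMap.id ℝ E)) y :=
        (hρ.differentiable (by simp) (x - y)).hasFDerivAt.comp y ((hasFDerivAt_id y).const_sub x)
      rw [euclideanDiv_smul hd.differentiableAt (hZ.differentiable (by simp) y), hd.fderiv]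
      simp
      ring
    have e := hμν _ hφ hφc hsupp
    rw [setIntegral_eq_integral_of_forall_compl_eq_zero
      (fun y hy => by rw [hv0 y hy, zero_mul])] at e
    have i1 : Integrable fun y => fderiv ℝ ρ (x - y) (Z x) * v y :=
      hv.mul_of_hasCompactSupport (f := fun y => fderiv ℝ ρ (x - y) (Z x))
        ((hdρ.comp (continuous_const.sub continuous_id)).clm_apply continuous_const)
        ((hρc.fderiv_apply ℝ (Z x)).comp_homeomorph (Homeomorph.subLeft x))
    have i2 : Integrable fun y => v y * euclideanDiv (fun y => ρ (x - y) • Z y) y := by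
      simp_rw [mul_comm (v _)]
      exact hv.mul_of_hasCompactSupport (continuous_euclideanDiv_smul hφ hZ)
        (hasCompactSupport_euclideanDiv_smul hφc)
    -- The distributional identity tested with `y ↦ ρ (x - y)` trades the derivative of the
    -- mollification for the mollified measure plus a commutator.
    have e2 : fderiv ℝ (ρ ⋆[ContinuousLinearMap.lsmul ℝ ℝ, volume] v) x (Z x)
        = (∫ y, (fderiv ℝ ρ (x - y) (Z x) * v y
            + v y * euclideanDiv (fun y => ρ (x - y) • Z y) y))
          + ∫ y, ρ (x - y) ∂μ - ∫ y, ρ (x - y) ∂ν := by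
      rw [fderiv_convolution_apply hρ hρc hv.locallyIntegrable, integral_add i1 i2]
      linarith
    rw [e2]
    refine enorm_sub_le.trans (add_le_add ((enorm_add_le _ _).trans (add_le_add ?_ ?_)) ?_)
    · refine (enorm_integral_le_lintegral_enorm _).trans (lintegral_mono fun y => ?_)
      by_cases hy : y ∈ Ω
      -- In the commutator `∇ρ` meets only `Z x - Z y`, of size at most `L ‖x - y‖`. This factor
      -- compensates the blow-up of `∇ρ` as the mollifier concentrates.
      · have e3 : fderiv ℝ ρ (x - y) (Z x) * v y
            + v y * euclideanDiv (fun y => ρ (x - y) • Z y) y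
            = v y * (fderiv ℝ ρ (x - y) (Z x - Z y) + euclideanDiv Z y * ρ (x - y)) := by
          rw [hdiv, map_sub]
          ring
        rw [e3, enorm_mul]
        gcongr
        refine (enorm_add_le _ _).trans (add_le_add ?_ ?_)
        · refine (ContinuousLinearMap.le_opENorm _ _).trans ?_
          rw [mul_comm, ← mul_assoc]
          gcongr
          have := hL hxΩ hy
          rwa [edist_eq_enorm_sub, edist_eq_enorm_sub] at this
        · rw [enorm_mul]
          gcongr
          rw [← ofReal_norm, ← ENNReal.ofReal_coe_nnreal]
          exact ENNReal.ofReal_le_ofReal (hM y hy)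
      · simp [hv0 y hy]
    · exact enorm_integral_le_lintegral_enorm _
    · exact enorm_integral_le_lintegral_enorm _
  have hone : ∀ m : Measure E, IsFiniteMeasure m →
      ∫⁻ x, ∫⁻ y, ‖ρ (x - y)‖ₑ ∂m = (∫⁻ z, ‖ρ z‖ₑ) * m univ := by
    intro m _
    simpa using lintegral_lintegral_mul_comp_sub (m := m) hρm (measurable_const (a := 1))
  calc _ ≤ ∫⁻ x in K, ((∫⁻ y, ‖v y‖ₑ * h (x - y)) + (∫⁻ y, ‖ρ (x - y)‖ₑ ∂μ)
          + ∫⁻ y, ‖ρ (x - y)‖ₑ ∂ν) := setLIntegral_mono' hK pointwise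
    _ ≤ ∫⁻ x, ((∫⁻ y, ‖v y‖ₑ * h (x - y)) + (∫⁻ y, ‖ρ (x - y)‖ₑ ∂μ)
          + ∫⁻ y, ‖ρ (x - y)‖ₑ ∂ν) := setLIntegral_le_lintegral _ _
    _ = _ := by
      have m1 : ∀ m : Measure E, IsFiniteMeasure m →
          Measurable fun x => ∫⁻ y, ‖ρ (x - y)‖ₑ ∂m := fun m _ =>
        (hρm.comp (measurable_fst.sub measurable_snd)).lintegral_prod_right'
      rw [lintegral_add_right _ (m1 ν inferInstance), lintegral_add_right _ (m1 μ inferInstance),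
        hone μ inferInstance, hone ν inferInstance,
        lintegral_lintegral_mul_comp_sub hhm hvm.enorm]

/-- A function of finite variation along `Z` is an almost everywhere limit of smooth functions
whose derivatives along `Z` are bounded in `L¹` on compact sets. -/
lemma HasFiniteFieldVariation.exists_smooth_approximation {Z : E → E} (hZ : ContDiff ℝ 1 Z)
    {Ω : Set E} (hΩ : IsOpen Ω) (hΩb : Bornology.IsBounded Ω) {v : E → ℝ}
    (hvm : Measurable v) (hv : Integrable v) (hv0 : ∀ x ∉ Ω, v x = 0)
    (h : HasFiniteFieldVariation Z Ω v) :
    ∃ (w : ℕ → E → ℝ) (K : ℕ → Set E) (C : ℝ≥0), (∀ k, ContDiff ℝ 1 (w k)) ∧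
      (∀ Q ⊆ Ω, IsCompact Q → ∀ᶠ k in atTop, Q ⊆ K k) ∧
      (∀ k, ∫⁻ x in K k, ‖fderiv ℝ (w k) x (Z x)‖ₑ ≤ C) ∧
      ∀ᵐ x, Tendsto (fun k => w k x) atTop (𝓝 (v x)) := by
  obtain ⟨μ, ν, hμ, hν, hμν⟩ := h
  obtain ⟨R, hR⟩ := hΩb.subset_closedBall 0
  obtain ⟨L, hL⟩ := hZ.contDiffOn.exists_lipschitzOnWith (s := Metric.closedBall (0 : E) R)
    one_ne_zero (convex_closedBall _ _) (isCompact_closedBall _ _)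
  obtain ⟨M, hM⟩ := (isCompact_closedBall (0 : E) R).exists_bound_of_continuousOn
    (continuous_euclideanDiv hZ).continuousOn
  have hr : ∀ k : ℕ, (0 : ℝ) < 1 / (k + 1) := fun k => by positivity
  let b : ℕ → ContDiffBump (0 : E) := fun k => scaledBump E (hr k)
  let ρ : ℕ → E → ℝ := fun k => (b k).normed volume
  have hρ : ∀ k, ContDiff ℝ 1 (ρ k) := fun k => (b k).contDiff_normed (n := 1)
  have hρc : ∀ k, HasCompactSupport (ρ k) := fun k => (b k).hasCompactSupport_normed
  have hρ1 : ∀ k, ∫⁻ z, ‖ρ k z‖ₑ = 1 := by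
    intro k
    rw [← ofReal_integral_norm_eq_lintegral_enorm (b k).integrable_normed]
    have : ∀ z, ‖ρ k z‖ = ρ k z := fun z => Real.norm_of_nonneg ((b k).nonneg_normed z)
    rw [integral_congr_ae (Eventually.of_forall this), (b k).integral_normed, ENNReal.ofReal_one]
  let A : ℝ := (∫ z, ‖z‖ * ‖fderiv ℝ (scaledBump E one_pos) z‖) / ∫ z, scaledBump E one_pos z
  have hρ2 : ∀ k, ∫⁻ z, ‖z‖ₑ * ‖fderiv ℝ (ρ k) z‖ₑ = ENNReal.ofReal A := by
    intro k
    have hi : Integrable fun z => ‖z‖ * ‖fderiv ℝ (ρ k) z‖ :=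
      (continuous_norm.mul
        ((hρ k).continuous_fderiv (by simp)).norm).integrable_of_hasCompactSupport
        ((hρc k).fderiv ℝ).norm.mul_left
    have hA : A = ∫ z, ‖z‖ * ‖fderiv ℝ (ρ k) z‖ :=
      (integral_norm_mul_norm_fderiv_normed_scaledBump (E := E) (hr k)).symm
    rw [hA,
      ofReal_integral_eq_lintegral_ofReal hi (Eventually.of_forall fun z => by positivity)]
    refine lintegral_congr fun z => ?_
    rw [ENNReal.ofReal_mul (norm_nonneg _), ofReal_norm, ofReal_norm]
  -- With `r = 1/(k+1)` the mollifier has outer radius `2r`; a distance of at least `3r` from the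
  -- complement keeps its closed support, centred in `K k`, inside `Ω`.
  let K : ℕ → Set E := fun k => (Metric.thickening (3 * (1 / (k + 1))) Ωᶜ)ᶜ
  have hK : ∀ k, MeasurableSet (K k) := fun k => Metric.isOpen_thickening.measurableSet.compl
  have hKΩ : ∀ k, ∀ x ∈ K k, ∀ y, dist x y < 3 * (1 / (k + 1)) → y ∈ Ω := by
    intro k x hx y hy
    by_contra hyΩ
    exact hx (Metric.mem_thickening_iff.2 ⟨y, hyΩ, hy⟩)
  let C : ℝ≥0∞ := (L * ENNReal.ofReal A + M.toNNReal) * (∫⁻ y, ‖v y‖ₑ) + μ univ + ν univ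
  have hC : C ≠ ⊤ := by
    have : ∫⁻ y, ‖v y‖ₑ ≠ ⊤ := hv.2.ne
    finiteness
  refine ⟨fun k => ρ k ⋆[ContinuousLinearMap.lsmul ℝ ℝ, volume] v, K, C.toNNReal,
    fun k => ?_, fun Q hQ hQc => ?_, fun k => ?_, ?_⟩
  · exact (hρc k).contDiff_convolution_left (n := 1) _ (hρ k) hv.locallyIntegrable
  · obtain ⟨δ, hδ, hδΩ⟩ := hQc.exists_thickening_subset_open hΩ hQ
    have hlim : Tendsto (fun k : ℕ => 3 * (1 / ((k : ℝ) + 1))) atTop (𝓝 0) := by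
      simpa using tendsto_one_div_add_atTop_nhds_zero_nat.const_mul (3 : ℝ)
    filter_upwards [hlim.eventually (gt_mem_nhds hδ)] with k hk x hx hx'
    obtain ⟨y, hy, hxy⟩ := Metric.mem_thickening_iff.1 hx'
    exact hy (hδΩ (Metric.mem_thickening_iff.2 ⟨x, hx, by rw [dist_comm]; exact hxy.trans hk⟩))
  · rw [ENNReal.coe_toNNReal hC]
    refine (setLIntegral_enorm_fderiv_convolution_le (Ω := Ω) hZ (hL.mono hR) (M := M.toNNReal)
      (fun x hx => (hM x (hR hx)).trans (Real.le_coe_toNNReal M)) hvm hv hv0 hμν (hρ k) (hρc k)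
      (hK k) fun x hx => ⟨?_, ?_⟩).trans_eq ?_
    · exact hKΩ k x hx x (by rw [dist_self]; positivity)
    · refine (closure_minimal (t := Metric.closedBall x (2 * (1 / (k + 1)))) (fun y hy => ?_)
        Metric.isClosed_closedBall).trans fun y hy => hKΩ k x hx y ?_
      · have : x - y ∈ Function.support (ρ k) := hy
        rw [ContDiffBump.support_normed_eq] at this
        rw [Metric.mem_closedBall, dist_comm, dist_eq_norm]
        exact (mem_ball_zero_iff.1 this).le
      · rw [dist_comm]
        have := hr k
        exact (Metric.mem_closedBall.1 hy).trans_lt (by linarith)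
    · rw [hρ1, lintegral_add_right _ (by
        have := (hρ k).continuous.enorm.measurable
        fun_prop), lintegral_const_mul' _ _ (by simp), lintegral_const_mul' _ _ (by simp), hρ1, hρ2]
      simp [C]
  -- Lebesgue differentiation; the constant 2 is the fixed ratio of outer to inner radius.
  · refine ContDiffBump.ae_convolution_tendsto_right_of_locallyIntegrable (K := 2) ?_
      (Eventually.of_forall fun k => le_rfl) hv.locallyIntegrable
    simpa [b, scaledBump] using tendsto_one_div_add_atTop_nhds_zero_nat.const_mul (2 : ℝ)

end Mollification

/-! ### Functions of finite variation have subgraphs of finite variation -/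

section SubgraphOfVariation

open scoped NNReal ENNReal

lemma continuous_integral_Iic {f : ℝ → ℝ} (hf : Continuous f) (hi : Integrable f) :
    Continuous fun s => ∫ t in Iic s, f t := by
  have h : ∀ s, ∫ t in Iic s, f t = (∫ t in Iic 0, f t) + ∫ t in (0)..s, f t := by
    intro s
    rw [← intervalIntegral.integral_Iic_sub_Iic hi.integrableOn hi.integrableOn]
    ring
  exact (continuous_const.add (intervalIntegral.continuous_primitive
    (fun _ _ => hf.intervalIntegrable _ _) 0)).congr fun s => (h s).symm

/-- The measure with density `D` on `K`, transported to the graph of `w`. -/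
noncomputable def graphMeasure {E : Type*} [MeasureSpace E] (w D : E → ℝ) (K : Set E) :
    Measure (E × ℝ) :=
  ((volume.restrict K).withDensity fun x => ENNReal.ofReal (D x)).map fun x => (x, w x)

lemma graphMeasure_univ_le {E : Type*} [MeasureSpace E] {w D : E → ℝ} (hw : Measurable w)
    (K : Set E) : graphMeasure w D K univ ≤ ∫⁻ x in K, ‖D x‖ₑ := by
  rw [graphMeasure, Measure.map_apply (by fun_prop) MeasurableSet.univ, preimage_univ,
    withDensity_apply _ MeasurableSet.univ, Measure.restrict_univ]
  exact lintegral_mono fun x => Real.ofReal_le_enorm _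

lemma integral_graphMeasure {E : Type*} [MeasureSpace E] {w D : E → ℝ} (hw : Measurable w)
    (hD : Measurable D) (K : Set E) {φ : E × ℝ → ℝ} (hφ : StronglyMeasurable φ) :
    ∫ p, φ p ∂(graphMeasure w D K) = ∫ x in K, max (D x) 0 * φ (x, w x) := by
  rw [graphMeasure, integral_map (by fun_prop) hφ.aestronglyMeasurable,
    integral_withDensity_eq_integral_toReal_smul (by fun_prop) (by simp)]
  simp [ENNReal.toReal_ofReal']

/-- The densities are the positive and negative parts of `D`. Cutting off to `K` is invisible to a
test function whose support projects into `K`. -/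
lemma integral_graphMeasure_sub {E : Type*} [NormedAddCommGroup E] [MeasureSpace E] [BorelSpace E]
    [(volume : Measure E).IsAddHaarMeasure] {w D : E → ℝ} (hw : Continuous w) (hD : Continuous D)
    {K : Set E} {φ : E × ℝ → ℝ} (hφ : Continuous φ)
    (hc : HasCompactSupport φ) (hK : Prod.fst '' tsupport φ ⊆ K) :
    ∫ p, φ p ∂(graphMeasure w D K) - ∫ p, φ p ∂(graphMeasure w (fun x => - D x) K)
      = ∫ x, φ (x, w x) * D x := by
  have hi : ∀ D : E → ℝ, Continuous D → Integrable fun x => max (D x) 0 * φ (x, w x) :=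
    fun D hD => Continuous.integrable_of_hasCompactSupport (by fun_prop)
      (hasCompactSupport_comp_graph hc w).mul_left
  rw [integral_graphMeasure hw.measurable hD.measurable K hφ.stronglyMeasurable,
    integral_graphMeasure (D := fun x => - D x) hw.measurable hD.neg.measurable K
      hφ.stronglyMeasurable,
    ← integral_sub (hi _ hD).integrableOn (hi (fun x => - D x) hD.neg).integrableOn]
  have e : ∀ x, max (D x) 0 * φ (x, w x) - max (-D x) 0 * φ (x, w x) = φ (x, w x) * D x := by
    intro x
    have := max_zero_sub_max_neg_zero_eq_self (D x)
    linear_combination φ (x, w x) * this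
  simp_rw [e]
  refine setIntegral_eq_integral_of_forall_compl_eq_zero fun x hx => ?_
  have : φ (x, w x) = 0 := by
    by_contra h
    exact hx (hK ⟨_, subset_tsupport _ h, rfl⟩)
  rw [this, zero_mul]

variable {E : Type*} [NormedAddCommGroup E] [NormedSpace ℝ E] [FiniteDimensional ℝ E]
  [MeasureSpace E] [BorelSpace E] [(volume : Measure E).IsAddHaarMeasure]

/-- The inner integral is continuous in its endpoint and bounded by the integral of `|g|` over the
fibre, so almost everywhere convergence suffices. -/
lemma tendsto_integral_integral_Iic {g : E × ℝ → ℝ} (hg : Continuous g)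
    (hc : HasCompactSupport g) {w : ℕ → E → ℝ} (hw : ∀ k, Measurable (w k)) {v : E → ℝ}
    (h : ∀ᵐ x, Tendsto (fun k => w k x) atTop (𝓝 (v x))) :
    Tendsto (fun k => ∫ x, ∫ t in Iic (w k x), g (x, t)) atTop
      (𝓝 (∫ x, ∫ t in Iic (v x), g (x, t))) := by
  have hi : Integrable g := hg.integrable_of_hasCompactSupport hc
  have hsl : ∀ x, Integrable fun t => g (x, t) := fun x =>
    Continuous.integrable_of_hasCompactSupport (by fun_prop) (hasCompactSupport_slice hc x)
  refine tendsto_integral_of_dominated_convergence (fun x => ∫ t, ‖g (x, t)‖)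
    (fun k => (integrable_integral_Iic (hw k) hi).aestronglyMeasurable)
    hi.integral_norm_prod_left (fun k => Eventually.of_forall fun x => ?_) ?_
  · exact (norm_integral_le_integral_norm _).trans
      (setIntegral_le_integral (hsl x).norm (Eventually.of_forall fun t => norm_nonneg _))
  · filter_upwards [h] with x hx
    exact ((continuous_integral_Iic (by fun_prop) (hsl x)).tendsto _).comp hx

/-- If `v` has finite variation along `Z`, then so has its subgraph along the lift of `Z`. -/
lemma HasFiniteFieldVariation.subgraph {Z : E → E} (hZ : ContDiff ℝ 1 Z)
    {Ω : Set E} (hΩ : IsOpen Ω) (hΩb : Bornology.IsBounded Ω) {v : E → ℝ}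
    (hvm : Measurable v) (hv : Integrable v) (hv0 : ∀ x ∉ Ω, v x = 0)
    (h : HasFiniteFieldVariation Z Ω v) :
    HasFiniteFieldVariation (horizontalLift Z) (Ω ×ˢ univ) (subgraphIndicator v) := by
  obtain ⟨w, K, C, hw, hKΩ, hC, hlim⟩ := h.exists_smooth_approximation hZ hΩ hΩb hvm hv hv0
  let D : ℕ → E → ℝ := fun k x => fderiv ℝ (w k) x (Z x)
  have hD : ∀ k, Continuous (D k) := fun k =>
    ((hw k).continuous_fderiv (by simp)).clm_apply hZ.continuous
  have hm1 : ∀ k, graphMeasure (w k) (D k) (K k) univ ≤ C := fun k =>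
    (graphMeasure_univ_le (hw k).continuous.measurable _).trans (hC k)
  have hm2 : ∀ k, graphMeasure (w k) (fun x => - D k x) (K k) univ ≤ C := fun k =>
    (graphMeasure_univ_le (hw k).continuous.measurable _).trans (by simpa using hC k)
  have : ∀ k, IsFiniteMeasure (graphMeasure (w k) (D k) (K k)) := fun k =>
    ⟨(hm1 k).trans_lt ENNReal.coe_lt_top⟩
  have : ∀ k, IsFiniteMeasure (graphMeasure (w k) (fun x => - D k x) (K k)) := fun k =>
    ⟨(hm2 k).trans_lt ENNReal.coe_lt_top⟩
  obtain ⟨μ, hμ, hμlim⟩ := exists_finite_measure_tendsto_integral (hyperfilter ℕ) _ C hm1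
  obtain ⟨ν, hν, hνlim⟩ := exists_finite_measure_tendsto_integral (hyperfilter ℕ) _ C hm2
  refine ⟨μ, ν, hμ, hν, fun φ h1 h2 h3 => ?_⟩
  have hg := continuous_euclideanDiv_smul h1 (contDiff_horizontalLift hZ)
  have hgc := hasCompactSupport_euclideanDiv_smul (Z := horizontalLift Z) h2
  have hQ : Prod.fst '' tsupport φ ⊆ Ω := by
    rintro _ ⟨p, hp, rfl⟩
    exact (h3 hp).1
  rw [setIntegral_subgraphIndicator_mul hvm Ω (hg.integrable_of_hasCompactSupport hgc),
    setIntegral_eq_integral_of_forall_compl_eq_zero]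
  -- The vague limits and the limit of the smooth identities are compared along the same
  -- ultrafilter. The identity for `w k` holds once `K k` contains the projected support of `φ`.
  · refine tendsto_nhds_unique ((hμlim φ h1.continuous h2).sub (hνlim φ h1.continuous h2))
      ((((tendsto_integral_integral_Iic hg hgc (fun k => (hw k).continuous.measurable)
        hlim).neg).mono_left Nat.hyperfilter_le_atTop).congr' ?_)
    refine (hKΩ _ hQ (h2.isCompact.image continuous_fst)).filter_mono
      Nat.hyperfilter_le_atTop |>.mono fun k hk => ?_
    simp only
    rw [integral_graphMeasure_sub (hw k).continuous (hD k) h1.continuous h2 hk,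
      integral_Iic_euclideanDiv_smul_horizontalLift h1 h2 hZ (hw k), neg_neg]
  · intro x hx
    have : ∀ t, euclideanDiv (fun q => φ q • horizontalLift Z q) (x, t) = 0 := fun t =>
      euclideanDiv_eq_zero_of_notMem_tsupport fun h => hx (hQ ⟨_, h, rfl⟩)
    simp [this]

end SubgraphOfVariation

/-! ### The theorem -/

lemma MeasureTheory.LocallyIntegrableOn.congr_ae_restrict {α F : Type*} [MeasurableSpace α]
    [TopologicalSpace α] [NormedAddCommGroup F] {μ : Measure α} {s : Set α} {f g : α → F}
    (hf : LocallyIntegrableOn f s μ) (h : f =ᵐ[μ.restrict s] g) : LocallyIntegrableOn g s μ := by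
  intro x hx
  obtain ⟨t, ht, hft⟩ := hf x hx
  refine ⟨t ∩ s, inter_mem ht self_mem_nhdsWithin, ?_⟩
  exact (hft.mono_set inter_subset_left).congr
    (ae_mono (Measure.restrict_mono inter_subset_right le_rfl) h)

/-- Extension by zero gives a function that can be convolved on all of `E`; joint measurability of
its subgraph follows from that of the representative. -/
lemma exists_measurable_representative {E : Type*} [MeasureSpace E] {Ω : Set E}
    (hΩ : MeasurableSet Ω) {u : E → ℝ} (hu : IntegrableOn u Ω) :
    ∃ v : E → ℝ, Measurable v ∧ Integrable v ∧ (∀ x ∉ Ω, v x = 0) ∧ u =ᵐ[volume.restrict Ω] v := by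
  have hae := hu.aestronglyMeasurable.ae_eq_mk
  refine ⟨Ω.indicator (hu.aestronglyMeasurable.mk u),
    hu.aestronglyMeasurable.stronglyMeasurable_mk.measurable.indicator hΩ,
    (integrable_indicator_iff hΩ).2 (hu.congr hae), fun x hx => indicator_of_notMem hx _, ?_⟩
  filter_upwards [hae, ae_restrict_mem hΩ] with x hx hxΩ
  rw [indicator_of_mem hxΩ, hx]

section SubgraphEquivalence

variable {E : Type*} [NormedAddCommGroup E] [NormedSpace ℝ E] [FiniteDimensional ℝ E]
  [MeasureSpace E] [(volume : Measure E).IsAddHaarMeasure]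

lemma indicator_subgraphOn_ae_eq {Ω : Set E} (hΩ : MeasurableSet Ω) {u v : E → ℝ}
    (huv : u =ᵐ[volume.restrict Ω] v) :
    (subgraphOn Ω u).indicator (fun _ => (1 : ℝ))
      =ᵐ[volume.restrict (Ω ×ˢ univ)] subgraphIndicator v := by
  have h1 : ∀ᵐ p : E × ℝ ∂(volume.restrict (Ω ×ˢ univ)), u p.1 = v p.1 := by
    rw [Measure.volume_eq_prod, ← Measure.prod_restrict]
    exact Measure.quasiMeasurePreserving_fst.ae huv
  filter_upwards [h1, ae_restrict_mem (hΩ.prod MeasurableSet.univ)] with p hp hpΩ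
  by_cases h : p.2 < v p.1
  · simp [subgraphOn, subgraphIndicator, hpΩ.1, hp, h]
  · simp [subgraphOn, subgraphIndicator, hp, h]

lemma locallyIntegrableOn_indicator_subgraphOn {Ω : Set E} (hΩ : MeasurableSet Ω) {u v : E → ℝ}
    (hv : Measurable v) (huv : u =ᵐ[volume.restrict Ω] v) :
    LocallyIntegrableOn ((subgraphOn Ω u).indicator fun _ => (1 : ℝ)) (Ω ×ˢ univ) := by
  have h : LocallyIntegrable (subgraphIndicator v) :=
    (locallyIntegrable_const (1 : ℝ)).mono (measurable_subgraphIndicator hv).aestronglyMeasurable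
      (Eventually.of_forall fun p => by simpa using norm_subgraphIndicator_le v p)
  exact (h.locallyIntegrableOn _).congr_ae_restrict (indicator_subgraphOn_ae_eq hΩ huv).symm

variable [BorelSpace E]

/-- A function on a bounded open set has finite variation along `Z` if and only if its subgraph
has finite variation along the lift of `Z`. -/
lemma hasFiniteFieldVariation_iff_subgraph {Z : E → E} (hZ : ContDiff ℝ 1 Z) {Ω : Set E}
    (hΩ : IsOpen Ω) (hΩb : Bornology.IsBounded Ω) {u : E → ℝ} (hu : IntegrableOn u Ω) :
    HasFiniteFieldVariation Z Ω u ↔ HasFiniteFieldVariation (horizontalLift Z) (Ω ×ˢ univ)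
      ((subgraphOn Ω u).indicator fun _ => (1 : ℝ)) := by
  obtain ⟨v, hvm, hv, hv0, huv⟩ := exists_measurable_representative hΩ.measurableSet hu
  have hS := indicator_subgraphOn_ae_eq hΩ.measurableSet huv
  exact ⟨fun h => ((h.congr_ae huv).subgraph hZ hΩ hΩb hvm hv hv0).congr_ae hS.symm,
    fun h => ((h.congr_ae hS).of_subgraph hvm hv.integrableOn hZ).congr_ae huv.symm⟩

end SubgraphEquivalence

namespace CarnotGroup

variable {E : Type*} [NormedAddCommGroup E] [NormedSpace ℝ E] [FiniteDimensional ℝ E]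

lemma contDiff_field (G : CarnotGroup E) (v : E) : ContDiff ℝ 1 (G.field v) :=
  (contDiff_leftInvariantField G.contDiff_mul v).of_le (by exact_mod_cast le_top)

lemma field_add (G : CarnotGroup E) (v w : E) :
    G.field (v + w) = fun x => G.field v x + G.field w x := by
  ext x
  simp [field, leftInvariantField]

lemma field_smul (G : CarnotGroup E) (c : ℝ) (v : E) :
    G.field (c • v) = fun x => c • G.field v x := by
  ext x
  simp [field, leftInvariantField]

lemma prodReal_field (G : CarnotGroup E) (w : E × ℝ) :
    G.prodReal.field w = fun p => (G.field w.1 p.1, w.2) :=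
  funext (G.leftInvariantField_prodRealMul w)

lemma mem_prodReal_layer_one (G : CarnotGroup E) (w : E × ℝ) :
    w ∈ G.prodReal.layer 1 ↔ w.1 ∈ G.layer 1 := by
  change w ∈ G.prodRealLayer 1 ↔ _
  simp [prodRealLayer, Submodule.mem_prod]

end CarnotGroup

theorem theorem1p3 {n m : ℕ} (G : CarnotGroup (EuclideanSpace ℝ (Fin n)))
    (X : Module.Basis (Fin m) ℝ (G.layer 1))
    (Y : Module.Basis (Fin (m + 1)) ℝ (G.prodReal.layer 1))
    (Ω : Set (EuclideanSpace ℝ (Fin n))) (hΩ : IsOpen Ω) (hΩb : Bornology.IsBounded Ω)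
    (u : EuclideanSpace ℝ (Fin n) → ℝ) (hu : IntegrableOn u Ω) :
    MemBVH (fun i => G.field (X i : EuclideanSpace ℝ (Fin n))) Ω u ↔
      HasFiniteHPerimeter
        (fun i => G.prodReal.field (Y i : EuclideanSpace ℝ (Fin n) × ℝ))
        (Ω ×ˢ Set.univ) (subgraphOn Ω u) := by
  have hΩ' : volume Ω ≠ ⊤ := hΩb.measure_lt_top.ne
  obtain ⟨v, hvm, -, -, huv⟩ := exists_measurable_representative hΩ.measurableSet hu
  have hloc := locallyIntegrableOn_indicator_subgraphOn hΩ.measurableSet hvm huv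
  have hvert : HasFiniteFieldVariation (fun _ => ((0, 1) : EuclideanSpace ℝ (Fin n) × ℝ))
      (Ω ×ˢ univ) ((subgraphOn Ω u).indicator fun _ => (1 : ℝ)) :=
    (hasFiniteFieldVariation_vertical hΩ' hvm).congr_ae
      (indicator_subgraphOn_ae_eq hΩ.measurableSet huv).symm
  have h1 := hasFiniteHVariation_basis_iff X (Z := fun v => G.field v) hu.locallyIntegrableOn
    (fun v => G.contDiff_field v) (fun v w => G.field_add v w) (fun c v => G.field_smul c v)
  have h2 := hasFiniteHVariation_basis_iff Y (Z := fun w => G.prodReal.field w) hloc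
    (fun w => G.prodReal.contDiff_field w) (fun v w => G.prodReal.field_add v w)
    (fun c w => G.prodReal.field_smul c w)
  rw [MemBVH, HasFiniteHPerimeter, h1, h2, and_iff_right hu, and_iff_right hloc]
  constructor
  · intro h w
    have hw := (hasFiniteFieldVariation_iff_subgraph (G.contDiff_field _) hΩ hΩb hu).1
      (h ⟨w.1.1, (G.mem_prodReal_layer_one w.1).1 w.2⟩)
    -- A first-layer vector `(w₁, c)` gives the lift of the field of `w₁` plus `c ∂_t`.
    have hsum := hw.add hloc (contDiff_horizontalLift (G.contDiff_field _)) contDiff_const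
      (hvert.const_smul w.1.2)
    convert hsum using 1
    rw [G.prodReal_field]
    ext p <;> simp [horizontalLift]
  · intro h w
    -- With vertical component 0 the field is exactly the horizontal lift.
    have hw := h ⟨(w.1, 0), (G.mem_prodReal_layer_one _).2 w.2⟩
    rw [G.prodReal_field] at hw
    exact (hasFiniteFieldVariation_iff_subgraph (G.contDiff_field _) hΩ hΩb hu).2 hw
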